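/- Let $n\ge 0$ and let $A(t)=(A_{ij}(t))$, $t\in\mathbb R$, be a curve of complex Hermitian $n\times n$ matrices whose entries are $C^\infty$ functions of $t$. Let $\mu_1,\dots,\mu_n:\mathbb R\to\mathbb R$ be a continuous choice of the eigenvalues of $A$ (for instance the eigenvalues in increasing order), that is, each $\mu_i$ is continuous and, for every $t$, the numbers $\mu_1(t),\dots,\mu_n(t)$ are all the eigenvalues of $A(t)$, counted with multiplicity. Say that $\mu_i$ and $\mu_j$ meet of infinite order at $t_0$ if $\mu_i(t)-\mu_j(t)=O(|t-t_0|^N)$ for all $N\in\mathbb N$ as $t\downarrow t_0$, or for all $N\in\mathbb N$ as $t\uparrow t_0$. Suppose that for all $i,j$, either $\mu_i(t)=\mu_j(t)$ for all $t\in\mathbb R$, or $\mu_i$ and $\mu_j$ do not meet of infinite order at any $t_0\in\mathbb R$. Then all the eigenvalues and all the eigenvectors can be chosen smoothly on all of $\mathbb R$: there are $C^\infty$ functions $\lambda_1,\dots,\lambda_n:\mathbb R\to\mathbb R$ and $v_1,\dots,v_n:\mathbb R\to\mathbb C^n$ such that for every $t\in\mathbb R$ the numbers $\lambda_1(t),\dots,\lambda_n(t)$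 are all the eigenvalues of $A(t)$, counted with multiplicity, $(v_1(t),\dots,v_n(t))$ is an orthonormal basis of $\mathbb C^n$, and $A(t)v_i(t)=\lambda_i(t)v_i(t)$ for all $i$. -/

import Mathlib

open scoped Topology ContDiff

/-- Two functions `x`, `y` of a real parameter meet of infinite order at `t₀`: their difference is
`O(|t - t₀| ^ N)` for every `N`, as `t` tends to `t₀` from the right or as `t` tends to `t₀` from
the left. For smooth `x` and `y` the one-sided conditions are equivalent to each other and say that
all derivatives of `x` and `y` (of order `≥ 0`) agree at `t₀`. For functions that are only
continuous, such as eigenvalues in increasing order, which change from one smooth branch to another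
where these cross, the contact has to be measured on each side. -/
def MeetOfInfiniteOrderAt (x y : ℝ → ℝ) (t₀ : ℝ) : Prop :=
  (∀ N : ℕ, (fun t => x t - y t) =O[𝓝[>] t₀] (fun t => (t - t₀) ^ N)) ∨
  (∀ N : ℕ, (fun t => x t - y t) =O[𝓝[<] t₀] (fun t => (t - t₀) ^ N))

/-- The functions `μ 0, …, μ (n - 1)` are a continuous choice of all eigenvalues of the curve of
hermitian matrices `A`: each `μ i` is continuous, and for every `t` the numbers `μ i t` are the
roots of the characteristic polynomial of `A t`, counted with multiplicity. -/
structure IsContinuousEigenvalues {n : ℕ} (A : ℝ → Matrix (Fin n) (Fin n) ℂ)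
    (μ : Fin n → ℝ → ℝ) : Prop where
  continuous : ∀ i, Continuous (μ i)
  charpoly_eq : ∀ t, (A t).charpoly = ∏ i, (Polynomial.X - Polynomial.C (μ i t : ℂ))

open scoped Matrix

/-! Local existence goes by induction on the size of the matrix. Let `τ` be the normalized trace of
`B`. If `B - τ • 1` is flat at `t₀`, Gershgorin's theorem puts all eigenvalues within a flat error
of `τ`, so any two of them meet of infinite order on each side. By hypothesis they then coincide
there, `B` is scalar near `t₀`, and any constant frame works. Otherwise `B = τ • 1 + (t - t₀) ^ N •
C` with `C` smooth, hermitian, and nonzero of trace zero at `t₀`; hence `C t₀` has two distinct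
eigenvalues. The implicit function theorem splits `C` by a smooth unitary conjugation into two
smaller blocks with spectra on either side of a gap (`exists_unitary_blockDiagonal`). The hypothesis
must survive these reductions. It is therefore carried as `HasTameSpectrum`, a one-sided condition
that is stable under rescaling and under selecting the spectrum on one side of a gap.

The induction also shows that two eigenvalues of a local frame have the same germ or a contact of
finite order. Hence any smooth eigenvalue is locally one of those of the frame
(`IsLocalEigenframe.exists_eventuallyEq`), and smooth eigenvalues obey an identity principle.

This makes frames glue. Two frames near `b` have, after a permutation, the same eigenvalue germs,
and the unitary transition matrix between them mixes only columns whose eigenvalues have the same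
germ at `b`. Composed with a map that is the identity near `b` and takes values near `b`, it becomes
a globally smooth matrix that still mixes only such columns. By the identity principle these
eigenvalues agree all along the interval, so the second frame can be corrected by this matrix to
continue the first. Compact intervals, a half-line and finally the whole line follow. -/

theorem exists_smooth_reparametrization (t₀ : ℝ) {s : Set ℝ} (hs : s ∈ 𝓝 t₀) :
    ∃ φ : ℝ → ℝ, ContDiff ℝ ∞ φ ∧ (∀ᶠ t in 𝓝 t₀, φ t = t) ∧ ∀ t, φ t ∈ s := by
  obtain ⟨ε, hε, hεs⟩ := Metric.mem_nhds_iff.1 hs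
  let ψ : ContDiffBump t₀ := ⟨ε / 3, ε / 2, by positivity, by linarith⟩
  -- The bump function pulls every point to within `ε` of `t₀`. Composing with this map makes a
  -- function that is good only near `t₀` globally good, with the same germ.
  refine ⟨fun t => t₀ + ψ t * (t - t₀), ?_, ?_, fun t => hεs ?_⟩
  · exact contDiff_const.add (ψ.contDiff.mul (contDiff_id.sub contDiff_const))
  · filter_upwards [ψ.eventuallyEq_one] with t ht
    simp [ht]
  · rw [Metric.mem_ball, Real.dist_eq, add_sub_cancel_left, abs_mul, abs_of_nonneg ψ.nonneg]
    by_cases h : dist t t₀ < ε / 2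
    · rw [Real.dist_eq] at h
      nlinarith [ψ.le_one (x := t), ψ.nonneg (x := t), abs_nonneg (t - t₀)]
    · rw [ψ.zero_of_le_dist (not_lt.1 h)]
      simpa using hε

/-! ### Division of smooth functions by powers of `t - t₀` -/

section Division

variable {E : Type*} [NormedAddCommGroup E] [NormedSpace ℝ E]

theorem hasDerivAt_integral_pow_smul_comp (t₀ : ℝ) (k : ℕ) {h : ℝ → E} (hh : ContDiff ℝ 1 h)
    (t : ℝ) :
    HasDerivAt (fun t => ∫ s in (0 : ℝ)..1, s ^ k • h (t₀ + s * (t - t₀)))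
      (∫ s in (0 : ℝ)..1, s ^ (k + 1) • deriv h (t₀ + s * (t - t₀))) t := by
  have hd : Continuous (deriv h) := hh.continuous_deriv le_rfl
  have hc : Continuous h := hh.continuous
  have hF' : Continuous (fun p : ℝ × ℝ => p.2 ^ (k + 1) • deriv h (t₀ + p.2 * (p.1 - t₀))) := by
    fun_prop
  obtain ⟨C, hC⟩ := ((isCompact_closedBall t (1 : ℝ)).prod
    (isCompact_Icc (a := (0 : ℝ)) (b := 1))).exists_bound_of_continuousOn hF'.continuousOn
  refine (intervalIntegral.hasDerivAt_integral_of_dominated_loc_of_deriv_le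
    (F := fun t s => s ^ k • h (t₀ + s * (t - t₀)))
    (F' := fun t s => s ^ (k + 1) • deriv h (t₀ + s * (t - t₀)))
    (bound := fun _ => C) (Metric.ball_mem_nhds t one_pos) ?_ ?_ ?_ ?_ ?_ ?_).2
  · refine Filter.Eventually.of_forall fun x => Continuous.aestronglyMeasurable ?_
    fun_prop
  · refine Continuous.intervalIntegrable ?_ _ _
    fun_prop
  · refine Continuous.aestronglyMeasurable ?_
    fun_prop
  · refine Filter.Eventually.of_forall fun s hs x hx => hC (x, s)
      ⟨Metric.ball_subset_closedBall hx, ?_⟩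
    rw [Set.uIoc_of_le zero_le_one] at hs
    exact ⟨hs.1.le, hs.2⟩
  · exact intervalIntegrable_const
  · refine Filter.Eventually.of_forall fun s _ x _ => ?_
    have h1 : HasDerivAt (fun x => t₀ + s * (x - t₀)) s x := by
      simpa using (((hasDerivAt_id x).sub_const t₀).const_mul s).const_add t₀
    have h2 := ((hh.differentiable (by simp)).differentiableAt.hasDerivAt
      (x := t₀ + s * (x - t₀))).scomp x h1
    have h3 := h2.const_smul (s ^ k)
    rw [smul_smul, ← pow_succ] at h3
    exact h3

/-- Each differentiation under the integral sign produces a further factor `s`; the exponent `k` is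
left free so that the induction on `n` closes. -/
theorem contDiff_integral_pow_smul_comp (t₀ : ℝ) (n : ℕ) :
    ∀ (k : ℕ) {h : ℝ → E}, ContDiff ℝ ∞ h →
      ContDiff ℝ n (fun t => ∫ s in (0 : ℝ)..1, s ^ k • h (t₀ + s * (t - t₀))) := by
  induction n with
  | zero =>
    intro k h hh
    refine contDiff_zero.2 (continuous_iff_continuousAt.2 fun t => ?_)
    exact (hasDerivAt_integral_pow_smul_comp t₀ k (hh.of_le (by simp)) t).continuousAt
  | succ n ih =>
    intro k h hh
    have hd := hasDerivAt_integral_pow_smul_comp t₀ k (hh.of_le (by simp))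
    push_cast
    refine contDiff_succ_iff_deriv.2 ⟨fun t => (hd t).differentiableAt, by simp, ?_⟩
    rw [funext fun t => (hd t).deriv]
    exact ih (k + 1) (contDiff_infty_iff_deriv.1 hh).2

/-- Hadamard's lemma in one variable. -/
theorem ContDiff.exists_eq_sub_smul [CompleteSpace E] {f : ℝ → E} (hf : ContDiff ℝ ∞ f) {t₀ : ℝ}
    (h0 : f t₀ = 0) :
    ∃ g : ℝ → E, ContDiff ℝ ∞ g ∧ ∀ t, f t = (t - t₀) • g t := by
  have hd : ContDiff ℝ ∞ (deriv f) := (contDiff_infty_iff_deriv.1 hf).2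
  refine ⟨fun t => ∫ s in (0 : ℝ)..1, s ^ 0 • deriv f (t₀ + s * (t - t₀)),
    contDiff_infty.2 fun n => contDiff_integral_pow_smul_comp t₀ n 0 hd, fun t => ?_⟩
  have h1 : ∀ s ∈ Set.uIcc (0 : ℝ) 1, HasDerivAt (fun s => f (t₀ + s * (t - t₀)))
      ((t - t₀) • deriv f (t₀ + s * (t - t₀))) s := by
    intro s _
    have h1 : HasDerivAt (fun x => t₀ + x * (t - t₀)) (t - t₀) s := by
      simpa using ((hasDerivAt_id s).mul_const (t - t₀)).const_add t₀
    exact ((hf.differentiable (by simp)).differentiableAt.hasDerivAt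
      (x := t₀ + s * (t - t₀))).scomp s h1
  have h2 := intervalIntegral.integral_eq_sub_of_hasDerivAt h1
    (Continuous.intervalIntegrable (by have := hd.continuous; fun_prop) _ _)
  rw [intervalIntegral.integral_smul] at h2
  simpa [h0] using h2.symm

/-- A finite family of smooth functions either vanishes to infinite order at a point, or has a
common power of `t - t₀` as a factor such that the quotients do not all vanish. -/
theorem forall_isBigO_or_exists_eq_pow_smul [CompleteSpace E] {κ : Type*} (f : κ → ℝ → E)
    (hf : ∀ k, ContDiff ℝ ∞ (f k)) (t₀ : ℝ) :
    (∀ k, ∀ N : ℕ, f k =O[𝓝 t₀] fun t => (t - t₀) ^ N) ∨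
    ∃ (N : ℕ) (g : κ → ℝ → E), (∀ k, ContDiff ℝ ∞ (g k)) ∧
      (∀ k t, f k t = (t - t₀) ^ N • g k t) ∧ ∃ k, g k t₀ ≠ 0 := by
  by_cases h : ∀ N : ℕ, ∃ g : κ → ℝ → E, (∀ k, ContDiff ℝ ∞ (g k)) ∧
      ∀ k t, f k t = (t - t₀) ^ N • g k t
  · left
    intro k N
    obtain ⟨g, hg, hfg⟩ := h N
    rw [funext (hfg k)]
    simpa using (Asymptotics.isBigO_refl (fun t => (t - t₀) ^ N) (𝓝 t₀)).smul
      ((hg k).continuous.continuousAt.isBigO_one ℝ)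
  · right
    classical
    have h' : ∃ N : ℕ, ¬ ∃ g : κ → ℝ → E, (∀ k, ContDiff ℝ ∞ (g k)) ∧
      ∀ k t, f k t = (t - t₀) ^ N • g k t := not_forall.1 h
    have hN := Nat.find_spec h'
    have hpos : Nat.find h' ≠ 0 := fun h0 => hN ⟨f, hf, fun k t => by rw [h0, pow_zero, one_smul]⟩
    obtain ⟨M, hM⟩ := Nat.exists_eq_succ_of_ne_zero hpos
    obtain ⟨g, hg, hfg⟩ := not_not.1 (Nat.find_min h' (m := M) (by omega))
    refine ⟨M, g, hg, hfg, ?_⟩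
    -- `M` is the last exponent that divides the whole family. If all quotients vanished at `t₀`,
    -- Hadamard's lemma would divide out one more factor.
    by_contra! h0
    choose g' hg' hgg' using fun k => (hg k).exists_eq_sub_smul (h0 k)
    refine hN ⟨g', hg', fun k t => ?_⟩
    rw [hM, hfg, hgg', smul_smul, pow_succ]

end Division

/-- A curve of complex matrices all of whose entries are smooth. -/
def SmoothMatrix {ι κ : Type*} (B : ℝ → Matrix ι κ ℂ) : Prop :=
  ∀ i j, ContDiff ℝ ∞ fun t => B t i j

namespace SmoothMatrix

variable {ι κ l : Type*}

theorem mul [Fintype κ] {B : ℝ → Matrix ι κ ℂ} {C : ℝ → Matrix κ l ℂ} (hB : SmoothMatrix B)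
    (hC : SmoothMatrix C) : SmoothMatrix fun t => B t * C t := fun i j => by
  simp only [Matrix.mul_apply]
  exact ContDiff.sum fun k _ => (hB i k).mul (hC k j)

theorem conjTranspose {B : ℝ → Matrix ι κ ℂ} (hB : SmoothMatrix B) :
    SmoothMatrix fun t => (B t)ᴴ := fun i j =>
  Complex.conjCLE.contDiff.comp (hB j i)

theorem comp {B : ℝ → Matrix ι κ ℂ} (hB : SmoothMatrix B) {φ : ℝ → ℝ} (hφ : ContDiff ℝ ∞ φ) :
    SmoothMatrix fun t => B (φ t) := fun i j => (hB i j).comp hφ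

theorem const (B : Matrix ι κ ℂ) : SmoothMatrix fun _ => B := fun _ _ => contDiff_const

end SmoothMatrix

/-! ### Smooth block diagonalization by the implicit function theorem -/

section Splitting

variable {ι : Type*} [Fintype ι] [DecidableEq ι] (p : ι → Prop) [DecidablePred p]

/-- The vanishing of `splittingMap p (C, U)`, for a hermitian matrix `C`, says that `U` is
unitary, that the diagonal blocks of `U` with respect to `p` are hermitian, and that `Uᴴ * C * U`
is block diagonal. -/
def splittingMap (x : (ι → ι → ℂ) × (ι → ι → ℂ)) : ι → ι → ℂ := fun i j =>
  let C := Matrix.of x.1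
  let U := Matrix.of x.2
  if p i ↔ p j then (Uᴴ * U - 1 + (U - Uᴴ)) i j
  else if p i then (Uᴴ * (C * U)) i j else (Uᴴ * U) i j

theorem contDiff_splittingMap : ContDiff ℝ ω (splittingMap p) := by
  have h1 : ∀ i j : ι, ContDiff ℝ ω fun x : (ι → ι → ℂ) × (ι → ι → ℂ) => x.1 i j := by
    intro i j; fun_prop
  have h2 : ∀ i j : ι, ContDiff ℝ ω fun x : (ι → ι → ℂ) × (ι → ι → ℂ) => x.2 i j := by
    intro i j; fun_prop
  have h3 : ∀ i j : ι, ContDiff ℝ ω fun x : (ι → ι → ℂ) × (ι → ι → ℂ) => star (x.2 i j) :=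
    fun i j => Complex.conjCLE.contDiff.comp (h2 i j)
  have h4 : ∀ i j : ι, ContDiff ℝ ω fun x : (ι → ι → ℂ) × (ι → ι → ℂ) =>
      ((Matrix.of x.2)ᴴ * Matrix.of x.2) i j := by
    intro i j
    simp only [Matrix.mul_apply, Matrix.conjTranspose_apply, Matrix.of_apply]
    exact ContDiff.sum fun k _ => (h3 k i).mul (h2 k j)
  refine contDiff_pi.2 fun i => contDiff_pi.2 fun j => ?_
  by_cases hij : p i ↔ p j
  · simp only [splittingMap, if_pos hij, Matrix.add_apply, Matrix.sub_apply,
      Matrix.conjTranspose_apply, Matrix.of_apply]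
    exact ((h4 i j).sub contDiff_const).add ((h2 i j).sub (h3 j i))
  · by_cases hi : p i
    · simp only [splittingMap, if_neg hij, if_pos hi, Matrix.mul_apply,
        Matrix.conjTranspose_apply, Matrix.of_apply]
      exact ContDiff.sum fun k _ => (h3 k i).mul (ContDiff.sum fun l _ => (h1 k l).mul (h2 l j))
    · simp only [splittingMap, if_neg hij, if_neg hi]
      exact h4 i j

/-- The base point at which the implicit function theorem is applied to `splittingMap`. -/
def splittingBase (d : ι → ℝ) : (ι → ι → ℂ) × (ι → ι → ℂ) :=
  (Matrix.diagonal fun i => (d i : ℂ), (1 : Matrix ι ι ℂ))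

theorem hasDerivAt_splittingMap (d : ι → ℝ) (H : ι → ι → ℂ) :
    HasDerivAt (fun s : ℝ => splittingMap p (splittingBase d + s • (0, H)))
      (fun i j => if p i ↔ p j then 2 * H i j
        else if p i then (d i : ℂ) * H i j + star (H j i) * d j else H i j + star (H j i)) 0 := by
  set D : Matrix ι ι ℂ := Matrix.diagonal fun i => (d i : ℂ) with hD
  set M : Matrix ι ι ℂ := Matrix.of H with hM
  have e0 : ∀ s : ℝ, splittingBase d + s • ((0, H) : (ι → ι → ℂ) × (ι → ι → ℂ)) =
      (Matrix.of.symm D, Matrix.of.symm (1 + s • M)) := by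
    intro s
    ext i j
    · change D i j + s • (0 : ℂ) = D i j
      simp
    · rfl
  -- Along the line `U = 1 + s • M` with `C = D` fixed, every entry is quadratic in `s`; its
  -- derivative at `0` is the linear coefficient.
  have key : ∀ (F : ℝ → ℂ) (a b c : ℂ), (∀ s : ℝ, F s = a + s * b + s * s * c) →
      HasDerivAt F b 0 := by
    intro F a b c hF
    rw [funext hF]
    have h := (hasDerivAt_id (0 : ℝ)).ofReal_comp
    exact (((h.mul_const b).const_add a).add ((h.mul h).mul_const c)).congr_deriv (by simp)
  have e1 : ∀ s : ℝ, (1 + s • M)ᴴ * (1 + s • M) = 1 + s • (M + Mᴴ) + (s * s) • (Mᴴ * M) := by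
    intro s
    simp only [Matrix.conjTranspose_add, Matrix.conjTranspose_one, Matrix.conjTranspose_smul,
      star_trivial, Matrix.add_mul, Matrix.mul_add, one_mul, mul_one, Matrix.smul_mul,
      Matrix.mul_smul, smul_add, smul_smul]
    abel
  have e2 : ∀ s : ℝ, (1 + s • M)ᴴ * (D * (1 + s • M)) =
      D + s • (D * M + Mᴴ * D) + (s * s) • (Mᴴ * (D * M)) := by
    intro s
    simp only [Matrix.conjTranspose_add, Matrix.conjTranspose_one, Matrix.conjTranspose_smul,
      star_trivial, Matrix.add_mul, Matrix.mul_add, one_mul, mul_one, Matrix.smul_mul,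
      Matrix.mul_smul, smul_add, smul_smul]
    abel
  refine hasDerivAt_pi.2 fun i => hasDerivAt_pi.2 fun j => ?_
  simp only [e0, splittingMap, Equiv.apply_symm_apply, e1, e2]
  by_cases hij : p i ↔ p j
  · simp only [if_pos hij]
    refine key _ 0 (2 * H i j) ((Mᴴ * M) i j) fun s => ?_
    simp [Matrix.add_apply, hM]
    ring
  · by_cases hi : p i
    · simp only [if_neg hij, if_pos hi]
      refine key _ (D i j) _ ((Mᴴ * (D * M)) i j) fun s => ?_
      simp [Matrix.add_apply, hD, hM]
      ring
    · simp only [if_neg hij, if_neg hi]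
      refine key _ ((1 : Matrix ι ι ℂ) i j) _ ((Mᴴ * M) i j) fun s => ?_
      simp [Matrix.add_apply, hM]
      ring

theorem fderiv_splittingMap (d : ι → ℝ) (H : ι → ι → ℂ) :
    fderiv ℝ (splittingMap p) (splittingBase d) (0, H) =
      fun i j => if p i ↔ p j then 2 * H i j
        else if p i then (d i : ℂ) * H i j + star (H j i) * d j else H i j + star (H j i) := by
  have h1 : HasFDerivAt (splittingMap p) (fderiv ℝ (splittingMap p) (splittingBase d))
      (splittingBase d + (0 : ℝ) • (0, H)) := by
    rw [zero_smul, add_zero]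
    exact (((contDiff_splittingMap p).differentiable (by simp)) _).hasFDerivAt
  have h2 := ((hasDerivAt_id (0 : ℝ)).smul_const
    ((0, H) : (ι → ι → ℂ) × (ι → ι → ℂ))).const_add (splittingBase d)
  have h3 := HasFDerivAt.comp_hasDerivAt (0 : ℝ) h1 h2
  rw [one_smul] at h3
  exact h3.unique (hasDerivAt_splittingMap p d H)

/-- There are as many equations as unknowns, so injectivity suffices. Inside the diagonal blocks the
derivative is `2 * H`, the sum of `H + Hᴴ` and `H - Hᴴ`. Across blocks, unitarity gives `star (H j
i) = - H i j`, which turns the other equation into `(d i - d j) * H i j = 0`. -/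
theorem isInvertible_fderiv_splittingMap {d : ι → ℝ} (hd : ∀ i j, p i → ¬ p j → d i ≠ d j) :
    (fderiv ℝ (splittingMap p) (splittingBase d) ∘L
      .inr ℝ (ι → ι → ℂ) (ι → ι → ℂ)).IsInvertible := by
  set L := fderiv ℝ (splittingMap p) (splittingBase d) ∘L
      .inr ℝ (ι → ι → ℂ) (ι → ι → ℂ) with hL
  have hinj : Function.Injective (L : (ι → ι → ℂ) →ₗ[ℝ] (ι → ι → ℂ)) := by
    rw [← LinearMap.ker_eq_bot, LinearMap.ker_eq_bot']
    intro H hH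
    have hH' := (fderiv_splittingMap p d H).symm.trans hH
    have h1 : ∀ i j, p i → ¬ p j → H i j = 0 ∧ H j i = 0 := by
      intro i j hi hj
      have e1 := congrFun (congrFun hH' i) j
      have e2 := congrFun (congrFun hH' j) i
      simp only [hi, hj, iff_false, not_true, if_false, if_true, iff_true, Pi.zero_apply] at e1 e2
      have e3 : star (H j i) = - H i j := by
        rw [eq_neg_of_add_eq_zero_left e2]; simp
      have e4 : ((d i : ℂ) - d j) * H i j = 0 := by
        rw [e3] at e1; linear_combination e1
      have e5 : ((d i : ℂ) - d j) ≠ 0 := sub_ne_zero.2 (by exact_mod_cast hd i j hi hj)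
      have e6 := (mul_eq_zero.1 e4).resolve_left e5
      refine ⟨e6, ?_⟩
      simpa [e6] using e3
    funext i j
    by_cases hi : p i <;> by_cases hj : p j
    · have e1 := congrFun (congrFun hH' i) j
      simpa [hi, hj] using e1
    · exact (h1 i j hi hj).1
    · exact (h1 j i hj hi).2
    · have e1 := congrFun (congrFun hH' i) j
      simpa [hi, hj] using e1
  refine ⟨(LinearEquiv.ofInjectiveEndo _ hinj).toContinuousLinearEquiv, ?_⟩
  ext1 H
  rfl

/-- Smooth splitting of the spectrum: a smooth curve of hermitian matrices which is diagonal at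
`t₀` is, near `t₀`, smoothly unitarily equivalent to a block diagonal one, provided that the
spectra of the two blocks are disjoint at `t₀`. -/
theorem exists_unitary_blockDiagonal {C : ℝ → Matrix ι ι ℂ} (hC : SmoothMatrix C)
    (hCh : ∀ t, (C t).IsHermitian) {t₀ : ℝ} {d : ι → ℝ}
    (h0 : C t₀ = Matrix.diagonal fun i => (d i : ℂ))
    (hd : ∀ i j, p i → ¬ p j → d i ≠ d j) :
    ∃ U : ℝ → Matrix ι ι ℂ, SmoothMatrix U ∧ U t₀ = 1 ∧ (∀ᶠ t in 𝓝 t₀, (U t)ᴴ * U t = 1) ∧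
      ∀ᶠ t in 𝓝 t₀, ∀ i j, ¬ (p i ↔ p j) → ((U t)ᴴ * (C t * U t)) i j = 0 := by
  have cdf : ContDiffAt ℝ ω (splittingMap p) (splittingBase d) :=
    (contDiff_splittingMap p).contDiffAt
  have hinv := isInvertible_fderiv_splittingMap p hd
  set X := cdf.implicitFunction (by simp) hinv
  have hbase : (splittingBase d).1 = fun i j => C t₀ i j := by rw [h0]; rfl
  have hX0 : X (fun i j => C t₀ i j) = (1 : Matrix ι ι ℂ) := by
    rw [← hbase]; exact cdf.implicitFunction_apply_self (by simp) hinv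
  have hXs : ∀ᶠ c in 𝓝 (fun i j => C t₀ i j), ContDiffAt ℝ ω X c := by
    have := cdf.contDiffAt_implicitFunction (by simp) hinv
    rw [hbase] at this
    exact this.eventually (by simp)
  have hXe : ∀ᶠ c in 𝓝 (fun i j => C t₀ i j), splittingMap p (c, X c) = 0 := by
    have := cdf.eventually_apply_implicitFunction (by simp) hinv
    rw [hbase] at this
    filter_upwards [this] with c hc
    rw [hc]
    funext i j
    simp only [splittingMap, splittingBase]
    change (if p i ↔ p j then ((1 : Matrix ι ι ℂ)ᴴ * 1 - 1 + (1 - (1 : Matrix ι ι ℂ)ᴴ) :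
        Matrix ι ι ℂ) i j
      else if p i then ((1 : Matrix ι ι ℂ)ᴴ * ((Matrix.diagonal fun i => (d i : ℂ)) * 1) :
        Matrix ι ι ℂ) i j
      else ((1 : Matrix ι ι ℂ)ᴴ * 1 : Matrix ι ι ℂ) i j) = 0
    by_cases hij : p i ↔ p j
    · simp [hij]
    · have : i ≠ j := fun h => hij (h ▸ Iff.rfl)
      simp [hij, this]
  have hCs : ContDiff ℝ ∞ fun t => fun i j => C t i j :=
    contDiff_pi.2 fun i => contDiff_pi.2 fun j => hC i j
  have hCt : Filter.Tendsto (fun t => fun i j => C t i j) (𝓝 t₀) (𝓝 fun i j => C t₀ i j) :=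
    hCs.continuous.continuousAt
  -- The implicit function `X` is controlled only near `C t₀`; reparametrizing keeps `C (φ t)` in
  -- that region for every `t`, so that `U` is smooth on all of `ℝ`.
  obtain ⟨φ, hφ, hφ0, hφm⟩ := exists_smooth_reparametrization t₀
    ((hCt.eventually hXs).and (hCt.eventually hXe))
  set U : ℝ → Matrix ι ι ℂ := fun t => Matrix.of (X fun i j => C (φ t) i j) with hU
  have hUs : SmoothMatrix U := by
    have : ContDiff ℝ ∞ fun t => X fun i j => C (φ t) i j :=
      contDiff_iff_contDiffAt.2 fun t => ((hφm t).1.of_le (by simp)).comp t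
        (hCs.comp hφ).contDiffAt
    exact fun i j => contDiff_pi.1 (contDiff_pi.1 this i) j
  have hUe : ∀ᶠ t in 𝓝 t₀, splittingMap p (Matrix.of.symm (C t), Matrix.of.symm (U t)) = 0 := by
    filter_upwards [hφ0] with t ht
    have := (hφm t).2
    simp only [hU, ht] at this ⊢
    exact this
  have hUu : ∀ᶠ t in 𝓝 t₀, (U t)ᴴ * U t = 1 := by
    filter_upwards [hUe] with t ht
    have hh : ((U t)ᴴ * U t).IsHermitian := Matrix.isHermitian_conjTranspose_mul_self _
    -- Adding the conjugate of the transposed equation cancels the skew part `U - Uᴴ` and leaves the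
    -- hermitian part `Uᴴ * U - 1`.
    have hd : ∀ i j, (p i ↔ p j) → ((U t)ᴴ * U t) i j = (1 : Matrix ι ι ℂ) i j := by
      intro i j hij
      have e1 := congrFun (congrFun ht i) j
      have e2 := congrArg star (congrFun (congrFun ht j) i)
      simp only [splittingMap, if_pos hij, if_pos hij.symm, Equiv.apply_symm_apply,
        Matrix.add_apply, Matrix.sub_apply, Matrix.conjTranspose_apply, Pi.zero_apply, star_add,
        star_sub, star_star, star_zero, hh.apply, Matrix.isHermitian_one.apply] at e1 e2
      linear_combination (e1 + e2) / 2
    ext i j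
    by_cases hij : p i ↔ p j
    · exact hd i j hij
    · rw [Matrix.one_apply_ne (by rintro rfl; exact hij Iff.rfl)]
      by_cases hi : p i
      · have e2 := congrFun (congrFun ht j) i
        have hj : ¬ p j := fun hj => hij ⟨fun _ => hj, fun _ => hi⟩
        simp only [splittingMap, hi, hj, Equiv.apply_symm_apply, false_iff, not_true, if_false,
          Pi.zero_apply] at e2
        rw [← hh.apply, e2, star_zero]
      · have e2 := congrFun (congrFun ht i) j
        simpa only [splittingMap, if_neg hij, if_neg hi, Equiv.apply_symm_apply,
          Pi.zero_apply] using e2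
  refine ⟨U, hUs, ?_, hUu, ?_⟩
  · simp only [hU, hφ0.self_of_nhds, hX0]; rfl
  · filter_upwards [hUe] with t ht i j hij
    have hh : ((U t)ᴴ * (C t * U t)).IsHermitian := by
      rw [← Matrix.mul_assoc]
      exact Matrix.isHermitian_conjTranspose_mul_mul _ (hCh t)
    by_cases hi : p i
    · have e2 := congrFun (congrFun ht i) j
      simpa only [splittingMap, if_neg hij, if_pos hi, Equiv.apply_symm_apply,
        Pi.zero_apply] using e2
    · have hj : p j := by tauto
      have e2 := congrFun (congrFun ht j) i
      simp only [splittingMap, hi, hj, Equiv.apply_symm_apply, iff_false, not_true, if_false,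
          if_true, Pi.zero_apply] at e2
      rw [← hh.apply, e2, star_zero]

end Splitting

/-! ### Spectra of hermitian matrices and Gershgorin bounds -/

section LinearAlgebra

variable {ι : Type*} [Fintype ι] [DecidableEq ι]

/-- The columns of `V` are an orthonormal basis of eigenvectors of `M`, with eigenvalues `d`. -/
def IsEigenframe (M : Matrix ι ι ℂ) (d : ι → ℝ) (V : Matrix ι ι ℂ) : Prop :=
  Vᴴ * V = 1 ∧ M * V = V * Matrix.diagonal fun i => (d i : ℂ)

theorem charpoly_conjTranspose_mul_mul {U : Matrix ι ι ℂ} (hU : Uᴴ * U = 1) (M : Matrix ι ι ℂ) :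
    (Uᴴ * (M * U)).charpoly = M.charpoly := by
  rw [Matrix.charpoly_mul_comm, Matrix.mul_assoc, mul_eq_one_comm.1 hU, Matrix.mul_one]

theorem IsEigenframe.charpoly_eq {M V : Matrix ι ι ℂ} {d : ι → ℝ} (h : IsEigenframe M d V) :
    M.charpoly = ∏ i, (Polynomial.X - Polynomial.C (d i : ℂ)) := by
  rw [← charpoly_conjTranspose_mul_mul h.1, h.2, ← Matrix.mul_assoc, h.1, Matrix.one_mul,
    Matrix.charpoly_diagonal]

theorem isRoot_prod_X_sub_C {ι : Type*} [Fintype ι] (d : ι → ℝ) (x : ℝ) :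
    (∏ i, (Polynomial.X - Polynomial.C (d i : ℂ))).IsRoot (x : ℂ) ↔ ∃ i, d i = x := by
  simp [Polynomial.IsRoot.def, Polynomial.eval_prod, Finset.prod_eq_zero_iff, sub_eq_zero,
    eq_comm (a := x)]

theorem IsEigenframe.isRoot_iff {M V : Matrix ι ι ℂ} {d : ι → ℝ} (h : IsEigenframe M d V) (x : ℝ) :
    M.charpoly.IsRoot (x : ℂ) ↔ ∃ i, d i = x := by
  rw [h.charpoly_eq, isRoot_prod_X_sub_C]

theorem Matrix.IsHermitian.exists_isEigenframe {M : Matrix ι ι ℂ} (hM : M.IsHermitian) :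
    ∃ (d : ι → ℝ) (V : Matrix ι ι ℂ), IsEigenframe M d V := by
  refine ⟨hM.eigenvalues, hM.eigenvectorUnitary, Unitary.coe_star_mul_self _, ?_⟩
  have h := congrArg (· * (hM.eigenvectorUnitary : Matrix ι ι ℂ)) hM.spectral_theorem
  simp only [Unitary.conjStarAlgAut_apply, Matrix.mul_assoc, Unitary.coe_star_mul_self,
    Matrix.mul_one] at h
  exact h

/-- By the spectral theorem such a matrix is scalar. The scalar is expressed by the trace because
the trace of a smooth curve is smooth. -/
theorem eq_smul_one_of_isRoot_unique {M : Matrix ι ι ℂ} (hM : M.IsHermitian)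
    (h : ∀ x y : ℝ, M.charpoly.IsRoot (x : ℂ) → M.charpoly.IsRoot (y : ℂ) → x = y) :
    M = (((∑ i, (M i i).re) / Fintype.card ι : ℝ) : ℂ) • (1 : Matrix ι ι ℂ) := by
  obtain ⟨d, V, hV⟩ := hM.exists_isEigenframe
  cases isEmpty_or_nonempty ι with
  | inl _ => ext i; exact isEmptyElim i
  | inr hne =>
    obtain ⟨k⟩ := hne
    have hd : ∀ i, d i = d k := fun i =>
      h _ _ ((hV.isRoot_iff _).2 ⟨i, rfl⟩) ((hV.isRoot_iff _).2 ⟨k, rfl⟩)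
    have hMk : M = (d k : ℂ) • (1 : Matrix ι ι ℂ) := by
      have h1 : Matrix.diagonal (fun i => (d i : ℂ)) = (d k : ℂ) • (1 : Matrix ι ι ℂ) := by
        simp [hd, Matrix.smul_one_eq_diagonal]
      calc M = M * V * Vᴴ := by rw [Matrix.mul_assoc, mul_eq_one_comm.1 hV.1, Matrix.mul_one]
        _ = _ := by rw [hV.2, h1]; simp [mul_eq_one_comm.1 hV.1]
    have hc : (Fintype.card ι : ℝ) ≠ 0 := by
      have : 0 < Fintype.card ι := Fintype.card_pos_iff.2 ⟨k⟩
      positivity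
    conv_lhs => rw [hMk]
    rw [hMk]
    congr 2
    simp [hc]

/-- Gershgorin's theorem for real eigenvalues. -/
theorem exists_abs_sub_re_le_of_isRoot {M : Matrix ι ι ℂ} {x : ℝ}
    (hx : M.charpoly.IsRoot (x : ℂ)) :
    ∃ k, |x - (M k k).re| ≤ ∑ j ∈ Finset.univ.erase k, ‖M k j‖ := by
  rw [← Matrix.charpoly_toLin', ← Module.End.hasEigenvalue_iff_isRoot_charpoly] at hx
  obtain ⟨k, hk⟩ := eigenvalue_mem_ball hx
  refine ⟨k, le_trans ?_ (mem_closedBall_iff_norm.1 hk)⟩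
  simpa using Complex.abs_re_le_norm ((x : ℂ) - M k k)

theorem isRoot_charpoly_smul_one_add_smul_iff (a x : ℝ) {s : ℝ} (hs : s ≠ 0)
    (M : Matrix ι ι ℂ) :
    ((a : ℂ) • (1 : Matrix ι ι ℂ) + (s : ℂ) • M).charpoly.IsRoot ((a + s * x : ℝ) : ℂ) ↔
      M.charpoly.IsRoot (x : ℂ) := by
  have : Matrix.scalar ι ((a + s * x : ℝ) : ℂ) - ((a : ℂ) • (1 : Matrix ι ι ℂ) + (s : ℂ) • M) =
      (s : ℂ) • (Matrix.scalar ι (x : ℂ) - M) := by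
    ext i j
    by_cases h : i = j
    · subst h; simp; ring
    · simp [h]
  rw [Polynomial.IsRoot.def, Polynomial.IsRoot.def, Matrix.eval_charpoly, Matrix.eval_charpoly,
    this, Matrix.det_smul, mul_eq_zero, or_iff_right]
  exact pow_ne_zero _ (by exact_mod_cast hs)

/-- At `t₀` the Gershgorin radii vanish and the centers `d i` exceed `r`; centers and radii depend
continuously on `t`. -/
theorem eventually_lt_of_isRoot {C : ℝ → Matrix ι ι ℂ} (hC : ∀ i j, Continuous fun t => C t i j)
    {t₀ : ℝ} {d : ι → ℝ} (h0 : C t₀ = Matrix.diagonal fun i => (d i : ℂ)) {r : ℝ}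
    (hr : ∀ i, r < d i) :
    ∀ᶠ t in 𝓝 t₀, ∀ x : ℝ, (C t).charpoly.IsRoot (x : ℂ) → r < x := by
  have h1 : ∀ k, ∀ᶠ t in 𝓝 t₀, r < (C t k k).re - ∑ j ∈ Finset.univ.erase k, ‖C t k j‖ := by
    intro k
    have hcont : Continuous fun t => (C t k k).re - ∑ j ∈ Finset.univ.erase k, ‖C t k j‖ :=
      (Complex.continuous_re.comp (hC k k)).sub
        (continuous_finsetSum _ fun j _ => (hC k j).norm)
    refine hcont.continuousAt.eventually (lt_mem_nhds ?_)
    beta_reduce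
    rw [h0, Finset.sum_eq_zero]
    · simpa using hr k
    · intro j hj
      simp [Matrix.diagonal_apply_ne' _ (Finset.ne_of_mem_erase hj)]
  filter_upwards [Filter.eventually_all.2 h1] with t ht x hx
  obtain ⟨k, hk⟩ := exists_abs_sub_re_le_of_isRoot hx
  have := ht k
  rw [abs_le] at hk
  linarith

theorem eventually_gt_of_isRoot {C : ℝ → Matrix ι ι ℂ} (hC : ∀ i j, Continuous fun t => C t i j)
    {t₀ : ℝ} {d : ι → ℝ} (h0 : C t₀ = Matrix.diagonal fun i => (d i : ℂ)) {r : ℝ}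
    (hr : ∀ i, d i < r) :
    ∀ᶠ t in 𝓝 t₀, ∀ x : ℝ, (C t).charpoly.IsRoot (x : ℂ) → x < r := by
  have h1 : ∀ k, ∀ᶠ t in 𝓝 t₀, (C t k k).re + ∑ j ∈ Finset.univ.erase k, ‖C t k j‖ < r := by
    intro k
    have hcont : Continuous fun t => (C t k k).re + ∑ j ∈ Finset.univ.erase k, ‖C t k j‖ :=
      (Complex.continuous_re.comp (hC k k)).add
        (continuous_finsetSum _ fun j _ => (hC k j).norm)
    refine hcont.continuousAt.eventually (gt_mem_nhds ?_)
    beta_reduce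
    rw [h0, Finset.sum_eq_zero]
    · simpa using hr k
    · intro j hj
      simp [Matrix.diagonal_apply_ne' _ (Finset.ne_of_mem_erase hj)]
  filter_upwards [Filter.eventually_all.2 h1] with t ht x hx
  obtain ⟨k, hk⟩ := exists_abs_sub_re_le_of_isRoot hx
  have := ht k
  rw [abs_le] at hk
  linarith

end LinearAlgebra

/-! ### One-sided filters and spectra without contact of infinite order -/

section Tame

/-- The filters `𝓝[>] t₀` and `𝓝[<] t₀`, by the properties of them that are used. -/
structure IsOneSided (t₀ : ℝ) (l : Filter ℝ) : Prop where
  le_nhdsNE : l ≤ 𝓝[≠] t₀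
  neBot : l.NeBot
  exists_preconnected : ∀ s ∈ l, ∃ u ∈ l, u ⊆ s ∧ IsPreconnected u

theorem isOneSided_nhdsGT (t₀ : ℝ) : IsOneSided t₀ (𝓝[>] t₀) where
  le_nhdsNE := nhdsWithin_mono _ fun _ h => ne_of_gt h
  neBot := inferInstance
  exists_preconnected s hs := by
    obtain ⟨u, hu, hus⟩ := mem_nhdsGT_iff_exists_Ioo_subset.1 hs
    exact ⟨_, Ioo_mem_nhdsGT hu, hus, isPreconnected_Ioo⟩

theorem isOneSided_nhdsLT (t₀ : ℝ) : IsOneSided t₀ (𝓝[<] t₀) where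
  le_nhdsNE := nhdsWithin_mono _ fun _ h => ne_of_lt h
  neBot := inferInstance
  exists_preconnected s hs := by
    obtain ⟨u, hu, hus⟩ := mem_nhdsLT_iff_exists_Ioo_subset.1 hs
    exact ⟨_, Ioo_mem_nhdsLT hu, hus, isPreconnected_Ioo⟩

theorem IsOneSided.le_nhds {t₀ : ℝ} {l : Filter ℝ} (hl : IsOneSided t₀ l) : l ≤ 𝓝 t₀ :=
  hl.le_nhdsNE.trans nhdsWithin_le_nhds

theorem IsOneSided.eventually_ne {t₀ : ℝ} {l : Filter ℝ} (hl : IsOneSided t₀ l) :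
    ∀ᶠ t in l, t ≠ t₀ :=
  hl.le_nhdsNE self_mem_nhdsWithin

/-- A continuous function without zeros has a constant sign on one side of a point. -/
theorem IsOneSided.eventually_lt_or_eventually_gt {t₀ : ℝ} {l : Filter ℝ} (hl : IsOneSided t₀ l)
    {f g : ℝ → ℝ} (hf : ∀ᶠ t in l, ContinuousAt f t) (hg : ∀ᶠ t in l, ContinuousAt g t)
    (hne : ∀ᶠ t in l, f t ≠ g t) :
    (∀ᶠ t in l, f t < g t) ∨ ∀ᶠ t in l, g t < f t := by
  obtain ⟨u, hu, hus, hc⟩ := hl.exists_preconnected _ (hf.and (hg.and hne))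
  have hfu : ContinuousOn f u := fun t ht => (hus ht).1.continuousWithinAt
  have hgu : ContinuousOn g u := fun t ht => (hus ht).2.1.continuousWithinAt
  by_cases h : ∀ t ∈ u, f t < g t
  · exact Or.inl (Filter.mem_of_superset hu h)
  · right
    push Not at h
    obtain ⟨a, ha, hab⟩ := h
    refine Filter.mem_of_superset hu fun b hb => ?_
    by_contra hlt
    obtain ⟨c, hcu, hc⟩ := hc.intermediate_value₂ hb ha hfu hgu (not_lt.1 hlt) hab
    exact (hus hcu).2.2 hc

variable {ι : Type*} [Fintype ι] [DecidableEq ι]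

/-- Along the filter `l` at `t₀`, the real eigenvalues of `B` are the values of finitely many
continuous functions, two of which are eventually equal if their contact is of infinite order. -/
def HasTameSpectrum (B : ℝ → Matrix ι ι ℂ) (t₀ : ℝ) (l : Filter ℝ) : Prop :=
  ∃ (K : Type) (_ : Finite K) (μ : K → ℝ → ℝ),
    (∀ k, ∀ᶠ t in l, ContinuousAt (μ k) t) ∧
    (∀ᶠ t in l, ∀ x : ℝ, (B t).charpoly.IsRoot (x : ℂ) ↔ ∃ k, μ k t = x) ∧
    ∀ j k, (∀ N : ℕ, (fun t => μ j t - μ k t) =O[l] fun t => (t - t₀) ^ N) → μ j =ᶠ[l] μ k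

theorem HasTameSpectrum.congr {κ : Type*} [Fintype κ] [DecidableEq κ] {B : ℝ → Matrix ι ι ℂ}
    {C : ℝ → Matrix κ κ ℂ} {t₀ : ℝ} {l : Filter ℝ} (hB : HasTameSpectrum B t₀ l)
    (h : ∀ᶠ t in l, (C t).charpoly = (B t).charpoly) : HasTameSpectrum C t₀ l := by
  obtain ⟨K, hK, μ, h1, h2, h3⟩ := hB
  refine ⟨K, hK, μ, h1, ?_, h3⟩
  filter_upwards [h, h2] with t ht h2 x
  rw [ht, h2]

/-- The eigenvalues of `C` are `(μ k - τ) / (t - t₀) ^ N`. They need not be continuous at `t₀`,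
which is why tameness asks for continuity along `l` only. Contact of infinite order persists after
multiplication by the bounded factor `(t - t₀) ^ N`. -/
theorem HasTameSpectrum.affine {B C : ℝ → Matrix ι ι ℂ} {t₀ : ℝ} {l : Filter ℝ}
    (hl : IsOneSided t₀ l) (hB : HasTameSpectrum B t₀ l) {τ : ℝ → ℝ} (hτ : Continuous τ) {N : ℕ}
    (h : ∀ t, B t = (τ t : ℂ) • (1 : Matrix ι ι ℂ) + (((t - t₀) ^ N : ℝ) : ℂ) • C t) :
    HasTameSpectrum C t₀ l := by
  obtain ⟨K, hK, μ, h1, h2, h3⟩ := hB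
  refine ⟨K, hK, fun k t => (μ k t - τ t) / (t - t₀) ^ N, fun k => ?_, ?_, fun j k hjk => ?_⟩
  · filter_upwards [h1 k, hl.eventually_ne] with t ht hne
    exact (ht.sub hτ.continuousAt).div (by fun_prop) (pow_ne_zero _ (sub_ne_zero.2 hne))
  · filter_upwards [h2, hl.eventually_ne] with t ht hne x
    have hs : (t - t₀) ^ N ≠ 0 := pow_ne_zero _ (sub_ne_zero.2 hne)
    rw [← isRoot_charpoly_smul_one_add_smul_iff (τ t) x hs, ← h t, ht]
    refine exists_congr fun k => ?_
    rw [div_eq_iff hs]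
    constructor <;> intro h <;> linarith
  · have h4 := h3 j k fun M => ?_
    · filter_upwards [h4] with t ht
      rw [ht]
    · have hb : (fun t => (t - t₀) ^ N) =O[l] fun _ => (1 : ℝ) := by
        have : Continuous fun t : ℝ => (t - t₀) ^ N := by fun_prop
        exact (this.continuousAt.isBigO_one ℝ).mono hl.le_nhds
      have h5 := hb.mul (hjk M)
      simp only [one_mul] at h5
      refine h5.congr' ?_ Filter.EventuallyEq.rfl
      filter_upwards [hl.eventually_ne] with t hne
      have hs : (t - t₀) ^ N ≠ 0 := pow_ne_zero _ (sub_ne_zero.2 hne)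
      field_simp
      ring

/-- The part of the spectrum above, or below, a value which is not in the spectrum is tame. -/
theorem HasTameSpectrum.of_isRoot_iff_and {κ : Type*} [Fintype κ] [DecidableEq κ]
    {B : ℝ → Matrix ι ι ℂ} {C : ℝ → Matrix κ κ ℂ} {t₀ : ℝ} {l : Filter ℝ} (hl : IsOneSided t₀ l)
    (hB : HasTameSpectrum B t₀ l) {r : ℝ} (hr : ∀ᶠ t in l, ¬ (B t).charpoly.IsRoot (r : ℂ))
    {P : ℝ → Prop} (hP : P = (r < ·) ∨ P = (· < r))
    (h : ∀ᶠ t in l, ∀ x : ℝ, (C t).charpoly.IsRoot (x : ℂ) ↔ (B t).charpoly.IsRoot (x : ℂ) ∧ P x) :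
    HasTameSpectrum C t₀ l := by
  obtain ⟨K, hK, μ, h1, h2, h3⟩ := hB
  have hne : ∀ k, ∀ᶠ t in l, μ k t ≠ r := fun k => by
    filter_upwards [hr, h2] with t ht h2 hk
    exact ht ((h2 r).2 ⟨k, hk⟩)
  -- Along `l` the function `μ k` avoids `r`, so it stays on one side of `r`.
  have hsign : ∀ k, ∀ᶠ t in l, (P (μ k t) ↔ ∀ᶠ t in l, P (μ k t)) := by
    intro k
    have hneBot := hl.neBot
    have key : (∀ᶠ t in l, P (μ k t)) ∨ ∀ᶠ t in l, ¬ P (μ k t) := by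
      rcases hl.eventually_lt_or_eventually_gt (h1 k)
        (Filter.Eventually.of_forall fun t => continuousAt_const) (hne k) with h' | h' <;>
      rcases hP with rfl | rfl
      · exact Or.inr (h'.mono fun t ht => not_lt.2 ht.le)
      · exact Or.inl h'
      · exact Or.inl h'
      · exact Or.inr (h'.mono fun t ht => not_lt.2 ht.le)
    rcases key with h | h
    · filter_upwards [h] with t ht
      exact ⟨fun _ => h, fun _ => ht⟩
    · filter_upwards [h] with t ht
      refine ⟨fun h' => absurd h' ht, fun h' => ?_⟩
      obtain ⟨s, hs⟩ := (h.and h').exists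
      exact absurd hs.2 hs.1
  -- Since multiplicities are not recorded, a subfamily of the branches can serve for the smaller
  -- matrix without any counting.
  refine ⟨{k // ∀ᶠ t in l, P (μ k t)}, inferInstance, fun k => μ k, fun k => h1 k, ?_,
    fun j k => h3 j k⟩
  filter_upwards [h, h2, Filter.eventually_all.2 hsign] with t ht h2 hs x
  rw [ht, h2]
  constructor
  · rintro ⟨⟨k, rfl⟩, hk⟩
    exact ⟨⟨k, (hs k).1 hk⟩, rfl⟩
  · rintro ⟨k, rfl⟩
    exact ⟨⟨k, rfl⟩, (hs k).2 k.2⟩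

end Tame

/-- The function vanishes near `t₀`, or its order of vanishing at `t₀` is finite. -/
def SeparatedAt (t₀ : ℝ) (f : ℝ → ℝ) : Prop :=
  f =ᶠ[𝓝 t₀] 0 ∨ ∃ N : ℕ, (fun t => (t - t₀) ^ N) =O[𝓝 t₀] f

theorem SeparatedAt.pow_mul {t₀ : ℝ} {f : ℝ → ℝ} (hf : SeparatedAt t₀ f) (N : ℕ) :
    SeparatedAt t₀ fun t => (t - t₀) ^ N * f t := by
  rcases hf with hf | ⟨M, hM⟩
  · left
    filter_upwards [hf] with t ht
    simp [ht]
  · right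
    refine ⟨N + M, ?_⟩
    simp only [pow_add]
    exact (Asymptotics.isBigO_refl _ _).mul hM

theorem SeparatedAt.neg {t₀ : ℝ} {f : ℝ → ℝ} (hf : SeparatedAt t₀ f) :
    SeparatedAt t₀ fun t => - f t := by
  rcases hf with hf | ⟨M, hM⟩
  · left
    filter_upwards [hf] with t ht
    simp [ht]
  · exact Or.inr ⟨M, hM.neg_right⟩

theorem separatedAt_of_ne_zero {t₀ : ℝ} {f : ℝ → ℝ} (hf : ContinuousAt f t₀) (h0 : f t₀ ≠ 0) :
    SeparatedAt t₀ f := by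
  refine Or.inr ⟨0, ?_⟩
  simp only [pow_zero]
  refine (Asymptotics.isBigO_const_left_iff_pos_le_norm one_ne_zero).2
    ⟨‖f t₀‖ / 2, by positivity, ?_⟩
  have : ‖f t₀‖ / 2 < ‖f t₀‖ := half_lt_self (norm_pos_iff.2 h0)
  filter_upwards [hf.norm.eventually (lt_mem_nhds this)] with t ht using ht.le

/-! ### Operations on local eigenframes -/

section LocalFrame

variable {ι : Type*} [Fintype ι] [DecidableEq ι]

/-- Smooth eigenvalues `d` and smooth orthonormal eigenvectors, the columns of `V`, of the curve
`B` near `t₀`, such that any two of the eigenvalues coincide near `t₀` or have contact of finite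
order at `t₀`. -/
structure IsLocalEigenframe (B : ℝ → Matrix ι ι ℂ) (t₀ : ℝ) (d : ι → ℝ → ℝ)
    (V : ℝ → Matrix ι ι ℂ) : Prop where
  smooth_left : ∀ i, ContDiff ℝ ∞ (d i)
  smooth_right : SmoothMatrix V
  eventually : ∀ᶠ t in 𝓝 t₀, IsEigenframe (B t) (fun i => d i t) (V t)
  separated : ∀ i j, SeparatedAt t₀ fun t => d i t - d j t

theorem IsLocalEigenframe.affine {B C : ℝ → Matrix ι ι ℂ} {t₀ : ℝ} {d : ι → ℝ → ℝ}
    {V : ℝ → Matrix ι ι ℂ} (hC : IsLocalEigenframe C t₀ d V) {τ : ℝ → ℝ} (hτ : ContDiff ℝ ∞ τ)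
    {N : ℕ}
    (h : ∀ t, B t = (τ t : ℂ) • (1 : Matrix ι ι ℂ) + (((t - t₀) ^ N : ℝ) : ℂ) • C t) :
    IsLocalEigenframe B t₀ (fun i t => τ t + (t - t₀) ^ N * d i t) V where
  smooth_left i := hτ.add (((contDiff_id.sub contDiff_const).pow N).mul (hC.smooth_left i))
  smooth_right := hC.smooth_right
  eventually := by
    filter_upwards [hC.eventually] with t ht
    refine ⟨ht.1, ?_⟩
    rw [h, Matrix.add_mul, Matrix.smul_mul, Matrix.smul_mul, ht.2, Matrix.one_mul]
    ext i j
    simp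
    ring
  separated i j := by
    have := (hC.separated i j).pow_mul N
    convert this using 2
    ring

theorem IsLocalEigenframe.conj {C C' : ℝ → Matrix ι ι ℂ} {t₀ : ℝ} {d : ι → ℝ → ℝ}
    {V : ℝ → Matrix ι ι ℂ} (hC : IsLocalEigenframe C' t₀ d V) {W : ℝ → Matrix ι ι ℂ}
    (hW : SmoothMatrix W) (hWu : ∀ᶠ t in 𝓝 t₀, (W t)ᴴ * W t = 1)
    (h : ∀ᶠ t in 𝓝 t₀, C' t = (W t)ᴴ * (C t * W t)) :
    IsLocalEigenframe C t₀ d fun t => W t * V t where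
  smooth_left := hC.smooth_left
  smooth_right := hW.mul hC.smooth_right
  eventually := by
    filter_upwards [hC.eventually, hWu, h] with t ht hu h
    have hu' := mul_eq_one_comm.1 hu
    constructor
    · rw [Matrix.conjTranspose_mul, Matrix.mul_assoc, ← Matrix.mul_assoc _ (W t), hu,
        Matrix.one_mul, ht.1]
    · have h1 : W t * C' t = C t * W t := by
        rw [h, ← Matrix.mul_assoc, hu', Matrix.one_mul]
      rw [← Matrix.mul_assoc, ← h1, Matrix.mul_assoc, ht.2, Matrix.mul_assoc]
  separated := hC.separated

theorem IsLocalEigenframe.of_submatrix {κ : Type*} [Fintype κ] [DecidableEq κ] (e : κ ≃ ι)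
    {C : ℝ → Matrix ι ι ℂ} {t₀ : ℝ} {d : κ → ℝ → ℝ} {V : ℝ → Matrix κ κ ℂ}
    (hC : IsLocalEigenframe (fun t => (C t).submatrix e e) t₀ d V) :
    IsLocalEigenframe C t₀ (fun i => d (e.symm i)) fun t => (V t).submatrix e.symm e.symm where
  smooth_left i := hC.smooth_left _
  smooth_right i j := hC.smooth_right _ _
  eventually := by
    filter_upwards [hC.eventually] with t ht
    have h1 : C t = ((C t).submatrix e e).submatrix e.symm e.symm := by simp
    have h2 : (Matrix.diagonal fun i => (d (e.symm i) t : ℂ)) =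
        (Matrix.diagonal fun k => (d k t : ℂ)).submatrix e.symm e.symm := by
      rw [Matrix.submatrix_diagonal_equiv]; rfl
    constructor
    · rw [Matrix.conjTranspose_submatrix, Matrix.submatrix_mul_equiv, ht.1,
        Matrix.submatrix_one_equiv]
    · rw [h2, h1, Matrix.submatrix_mul_equiv, Matrix.submatrix_mul_equiv, ht.2]
  separated i j := hC.separated _ _

theorem IsLocalEigenframe.fromBlocks {κ : Type*} [Fintype κ] [DecidableEq κ]
    {C : ℝ → Matrix (ι ⊕ κ) (ι ⊕ κ) ℂ} {C₁ : ℝ → Matrix ι ι ℂ} {C₂ : ℝ → Matrix κ κ ℂ} {t₀ : ℝ}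
    {d₁ : ι → ℝ → ℝ} {d₂ : κ → ℝ → ℝ} {V₁ : ℝ → Matrix ι ι ℂ} {V₂ : ℝ → Matrix κ κ ℂ}
    (h₁ : IsLocalEigenframe C₁ t₀ d₁ V₁) (h₂ : IsLocalEigenframe C₂ t₀ d₂ V₂)
    (h : ∀ᶠ t in 𝓝 t₀, C t = Matrix.fromBlocks (C₁ t) 0 0 (C₂ t))
    (hne : ∀ i j, d₁ i t₀ ≠ d₂ j t₀) :
    IsLocalEigenframe C t₀ (Sum.elim d₁ d₂) fun t => Matrix.fromBlocks (V₁ t) 0 0 (V₂ t) where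
  smooth_left := by
    rintro (i | i)
    · exact h₁.smooth_left i
    · exact h₂.smooth_left i
  smooth_right := by
    rintro (i | i) (j | j)
    · exact h₁.smooth_right i j
    · exact contDiff_const
    · exact contDiff_const
    · exact h₂.smooth_right i j
  eventually := by
    filter_upwards [h₁.eventually, h₂.eventually, h] with t h₁ h₂ h
    constructor
    · simp [Matrix.fromBlocks_conjTranspose, Matrix.fromBlocks_multiply, h₁.1, h₂.1]
    · have : (Matrix.diagonal fun i => ((Sum.elim d₁ d₂ i t : ℝ) : ℂ)) =
          Matrix.fromBlocks (Matrix.diagonal fun i => (d₁ i t : ℂ)) 0 0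
            (Matrix.diagonal fun i => (d₂ i t : ℂ)) := by
        rw [Matrix.fromBlocks_diagonal]
        congr 1
        funext i
        cases i <;> rfl
      simp only [this, h, Matrix.fromBlocks_multiply, h₁.2, h₂.2, Matrix.mul_zero,
        Matrix.zero_mul, add_zero, zero_add]
  separated := by
    have key : ∀ i j, SeparatedAt t₀ fun t => d₁ i t - d₂ j t := fun i j =>
      separatedAt_of_ne_zero ((h₁.smooth_left i).sub (h₂.smooth_left j)).continuous.continuousAt
        (sub_ne_zero.2 (hne i j))
    rintro (i | i) (j | j)
    · exact h₁.separated i j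
    · exact key i j
    · simpa using (key j i).neg
    · exact h₂.separated i j

end LocalFrame

/-! ### Existence of local eigenframes -/

section Existence

variable {ι : Type} [Fintype ι] [DecidableEq ι]

/-- By Gershgorin every eigenvalue differs from `τ` by at most the sum of the norms of the entries
of `B - τ • 1`, which is flat. So any two branches meet of infinite order, and tameness makes them
equal. -/
theorem eventually_isRoot_unique_of_isBigO {B : ℝ → Matrix ι ι ℂ} {t₀ : ℝ} {l : Filter ℝ}
    (hl : IsOneSided t₀ l) (hB : HasTameSpectrum B t₀ l) (τ : ℝ → ℝ)
    (hflat : ∀ (i j : ι) (N : ℕ),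
      (fun t => (B t - (τ t : ℂ) • (1 : Matrix ι ι ℂ)) i j) =O[𝓝 t₀] fun t => (t - t₀) ^ N) :
    ∀ᶠ t in l, ∀ x y : ℝ, (B t).charpoly.IsRoot (x : ℂ) → (B t).charpoly.IsRoot (y : ℂ) →
      x = y := by
  obtain ⟨K, hK, μ, h1, h2, h3⟩ := hB
  set S : ℝ → ℝ := fun t => ∑ i, ∑ j, ‖(B t - (τ t : ℂ) • (1 : Matrix ι ι ℂ)) i j‖ with hS
  have hSO : ∀ N : ℕ, S =O[l] fun t => (t - t₀) ^ N := by
    intro N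
    have hS' : S = ∑ i, ∑ j, fun t => ‖(B t - (τ t : ℂ) • (1 : Matrix ι ι ℂ)) i j‖ := by
      funext t; simp [hS]
    rw [hS']
    exact (Asymptotics.IsBigO.sum fun i _ => Asymptotics.IsBigO.sum fun j _ =>
      (hflat i j N).norm_left).mono hl.le_nhds
  have hbound : ∀ (t x : ℝ), (B t).charpoly.IsRoot (x : ℂ) → |x - τ t| ≤ S t := by
    intro t x hx
    obtain ⟨k, hk⟩ := exists_abs_sub_re_le_of_isRoot hx
    have e1 : ∑ j ∈ Finset.univ.erase k, ‖B t k j‖ =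
        ∑ j ∈ Finset.univ.erase k, ‖(B t - (τ t : ℂ) • (1 : Matrix ι ι ℂ)) k j‖ := by
      refine Finset.sum_congr rfl fun j hj => ?_
      simp [Matrix.one_apply_ne' (Finset.ne_of_mem_erase hj)]
    have e2 : |(B t k k).re - τ t| ≤ ‖(B t - (τ t : ℂ) • (1 : Matrix ι ι ℂ)) k k‖ := by
      simpa using Complex.abs_re_le_norm ((B t - (τ t : ℂ) • (1 : Matrix ι ι ℂ)) k k)
    calc |x - τ t| ≤ |x - (B t k k).re| + |(B t k k).re - τ t| := abs_sub_le _ _ _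
      _ ≤ ∑ j, ‖(B t - (τ t : ℂ) • (1 : Matrix ι ι ℂ)) k j‖ := by
        rw [← Finset.sum_erase_add _ _ (Finset.mem_univ k), ← e1]
        exact add_le_add hk e2
      _ ≤ S t := Finset.single_le_sum
        (f := fun i => ∑ j, ‖(B t - (τ t : ℂ) • (1 : Matrix ι ι ℂ)) i j‖)
        (fun i _ => Finset.sum_nonneg fun j _ => norm_nonneg _) (Finset.mem_univ k)
  have hμ : ∀ k, ∀ N : ℕ, (fun t => μ k t - τ t) =O[l] fun t => (t - t₀) ^ N := by
    intro k N
    refine Asymptotics.IsBigO.trans ?_ (hSO N)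
    refine Asymptotics.IsBigO.of_bound 1 ?_
    filter_upwards [h2] with t ht
    rw [one_mul]
    exact (hbound t _ ((ht _).2 ⟨k, rfl⟩)).trans (le_abs_self _)
  have heq : ∀ j k, μ j =ᶠ[l] μ k := fun j k => h3 j k fun N => by
    simpa using (hμ j N).sub (hμ k N)
  filter_upwards [h2, Filter.eventually_all.2 fun j => Filter.eventually_all.2 (heq j)]
    with t ht he x y hx hy
  obtain ⟨j, rfl⟩ := (ht x).1 hx
  obtain ⟨k, rfl⟩ := (ht y).1 hy
  exact he j k

theorem isLocalEigenframe_one_of_isBigO {B : ℝ → Matrix ι ι ℂ} (hBh : ∀ t, (B t).IsHermitian)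
    {t₀ : ℝ} (hr : HasTameSpectrum B t₀ (𝓝[>] t₀)) (hl : HasTameSpectrum B t₀ (𝓝[<] t₀))
    {τ : ℝ → ℝ} (hτs : ContDiff ℝ ∞ τ) (hτ : ∀ t, τ t = (∑ i, (B t i i).re) / Fintype.card ι)
    (hflat : ∀ (i j : ι) (N : ℕ),
      (fun t => (B t - (τ t : ℂ) • (1 : Matrix ι ι ℂ)) i j) =O[𝓝 t₀] fun t => (t - t₀) ^ N) :
    IsLocalEigenframe B t₀ (fun _ => τ) fun _ => 1 where
  smooth_left _ := hτs
  smooth_right := SmoothMatrix.const 1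
  eventually := by
    have h1 : ∀ᶠ t in 𝓝 t₀, B t = (τ t : ℂ) • (1 : Matrix ι ι ℂ) := by
      rw [← nhdsNE_sup_pure, ← nhdsLT_sup_nhdsGT]
      refine Filter.eventually_sup.2 ⟨Filter.eventually_sup.2 ⟨?_, ?_⟩, ?_⟩
      · filter_upwards [eventually_isRoot_unique_of_isBigO (isOneSided_nhdsLT t₀) hl τ hflat]
          with t ht
        rw [hτ]
        exact eq_smul_one_of_isRoot_unique (hBh t) ht
      · filter_upwards [eventually_isRoot_unique_of_isBigO (isOneSided_nhdsGT t₀) hr τ hflat]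
          with t ht
        rw [hτ]
        exact eq_smul_one_of_isRoot_unique (hBh t) ht
      -- At `t₀` itself, the flatness bound with exponent `1` has right-hand side zero.
      · refine Filter.eventually_pure.2 (sub_eq_zero.1 ?_)
        ext i j
        obtain ⟨c, hc⟩ := (hflat i j 1).bound
        simpa using hc.self_of_nhds
    filter_upwards [h1] with t ht
    refine ⟨by simp, ?_⟩
    simp [ht, Matrix.smul_one_eq_diagonal]
  separated i j := Or.inl (by simp [Filter.EventuallyEq])

theorem SmoothMatrix.submatrix {ι κ : Type*} {B : ℝ → Matrix ι ι ℂ} (hB : SmoothMatrix B)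
    (f g : κ → ι) : SmoothMatrix fun t => (B t).submatrix f g := fun i j => hB (f i) (g j)

/-- A value `r` strictly between `d a` and `d b` and outside the spectrum at `t₀` cuts the matrix
into two blocks, both strictly smaller. Eigenvalues from different blocks lie on different sides of
`r`, hence are separated at `t₀`. -/
theorem exists_isLocalEigenframe_of_diagonal {C : ℝ → Matrix ι ι ℂ} (hC : SmoothMatrix C)
    (hCh : ∀ t, (C t).IsHermitian) {t₀ : ℝ} {d : ι → ℝ}
    (h0 : C t₀ = Matrix.diagonal fun i => (d i : ℂ)) {a b : ι} (hab : d a < d b)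
    (hr : HasTameSpectrum C t₀ (𝓝[>] t₀)) (hl : HasTameSpectrum C t₀ (𝓝[<] t₀))
    (ih : ∀ (κ : Type) [Fintype κ] [DecidableEq κ], Fintype.card κ < Fintype.card ι →
      ∀ B : ℝ → Matrix κ κ ℂ, SmoothMatrix B → (∀ t, (B t).IsHermitian) →
        HasTameSpectrum B t₀ (𝓝[>] t₀) → HasTameSpectrum B t₀ (𝓝[<] t₀) →
        ∃ d V, IsLocalEigenframe B t₀ d V) :
    ∃ d V, IsLocalEigenframe C t₀ d V := by
  classical
  obtain ⟨r, ⟨har, hrb⟩, hrd⟩ := (Set.Ioo_infinite hab).exists_notMem_finite (Set.finite_range d)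
  set p : ι → Prop := fun i => r < d i with hp
  obtain ⟨U, hU, hU0, hUu, hUC⟩ := exists_unitary_blockDiagonal p hC hCh h0
    (fun i j (hi : r < d i) hj h => hj (show r < d j from h ▸ hi))
  set D : ℝ → Matrix ι ι ℂ := fun t => (U t)ᴴ * (C t * U t) with hD
  have hDs : SmoothMatrix D := hU.conjTranspose.mul (hC.mul hU)
  have hDh : ∀ t, (D t).IsHermitian := fun t => by
    simp only [hD, ← Matrix.mul_assoc]
    exact Matrix.isHermitian_conjTranspose_mul_mul _ (hCh t)
  have hD0 : D t₀ = Matrix.diagonal fun i => (d i : ℂ) := by simp [hD, hU0, h0]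
  set e := Equiv.sumCompl p with he
  set C₁ : ℝ → Matrix {i // p i} {i // p i} ℂ := fun t =>
    (D t).submatrix Subtype.val Subtype.val with hC₁
  set C₂ : ℝ → Matrix {i // ¬ p i} {i // ¬ p i} ℂ := fun t =>
    (D t).submatrix Subtype.val Subtype.val with hC₂
  have hblocks : ∀ᶠ t in 𝓝 t₀, (D t).submatrix e e = Matrix.fromBlocks (C₁ t) 0 0 (C₂ t) := by
    filter_upwards [hUC] with t ht
    ext (i | i) (j | j)
    · rfl
    · exact ht i j fun h => j.2 (h.1 i.2)
    · exact ht i j fun h => i.2 (h.2 j.2)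
    · rfl
  have hchar : ∀ᶠ t in 𝓝 t₀, (C t).charpoly = (C₁ t).charpoly * (C₂ t).charpoly := by
    filter_upwards [hblocks, hUu] with t ht hu
    rw [← Matrix.charpoly_fromBlocks_zero₁₂, ← ht, ← charpoly_conjTranspose_mul_mul hu (C t)]
    exact (Matrix.charpoly_reindex e.symm (D t)).symm
  have hlt : ∀ᶠ t in 𝓝 t₀, ∀ x : ℝ, (C₁ t).charpoly.IsRoot (x : ℂ) → r < x := by
    refine eventually_lt_of_isRoot (C := C₁) (d := fun i => d i.1)
      (fun i j => (hDs i.1 j.1).continuous) ?_ fun i => i.2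
    simp only [hC₁, hD0]
    exact Matrix.submatrix_diagonal _ _ Subtype.val_injective
  have hgt : ∀ᶠ t in 𝓝 t₀, ∀ x : ℝ, (C₂ t).charpoly.IsRoot (x : ℂ) → x < r := by
    refine eventually_gt_of_isRoot (C := C₂) (d := fun i => d i.1)
      (fun i j => (hDs i.1 j.1).continuous) ?_
      fun i => lt_of_le_of_ne (not_lt.1 i.2) fun h => hrd ⟨i.1, h⟩
    simp only [hC₂, hD0]
    exact Matrix.submatrix_diagonal _ _ Subtype.val_injective
  have hroot : ∀ᶠ t in 𝓝 t₀, ∀ x : ℝ, (C t).charpoly.IsRoot (x : ℂ) ↔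
      (C₁ t).charpoly.IsRoot (x : ℂ) ∨ (C₂ t).charpoly.IsRoot (x : ℂ) := by
    filter_upwards [hchar] with t ht x
    rw [ht, Polynomial.root_mul]
  have hnr : ∀ᶠ t in 𝓝 t₀, ¬ (C t).charpoly.IsRoot (r : ℂ) := by
    filter_upwards [hroot, hlt, hgt] with t h h1 h2 hx
    rcases (h r).1 hx with hx | hx
    · exact lt_irrefl _ (h1 r hx)
    · exact lt_irrefl _ (h2 r hx)
  have ht1 : ∀ l, IsOneSided t₀ l → HasTameSpectrum C t₀ l → HasTameSpectrum C₁ t₀ l := by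
    intro l hl hC
    refine hC.of_isRoot_iff_and hl (hl.le_nhds hnr) (Or.inl rfl) ?_
    filter_upwards [hl.le_nhds hroot, hl.le_nhds hlt, hl.le_nhds hgt] with t h h1 h2 x
    rw [h]
    exact ⟨fun hx => ⟨Or.inl hx, h1 x hx⟩,
      fun hx => hx.1.resolve_right fun h' => lt_asymm hx.2 (h2 x h')⟩
  have ht2 : ∀ l, IsOneSided t₀ l → HasTameSpectrum C t₀ l → HasTameSpectrum C₂ t₀ l := by
    intro l hl hC
    refine hC.of_isRoot_iff_and hl (hl.le_nhds hnr) (Or.inr rfl) ?_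
    filter_upwards [hl.le_nhds hroot, hl.le_nhds hlt, hl.le_nhds hgt] with t h h1 h2 x
    rw [h]
    exact ⟨fun hx => ⟨Or.inr hx, h2 x hx⟩,
      fun hx => hx.1.resolve_left fun h' => lt_asymm hx.2 (h1 x h')⟩
  obtain ⟨d₁, V₁, hf₁⟩ := ih {i // p i} (Fintype.card_subtype_lt (x := a) (not_lt.2 har.le)) C₁
    (hDs.submatrix _ _) (fun t => (hDh t).submatrix _) (ht1 _ (isOneSided_nhdsGT t₀) hr)
    (ht1 _ (isOneSided_nhdsLT t₀) hl)
  obtain ⟨d₂, V₂, hf₂⟩ := ih {i // ¬ p i} (Fintype.card_subtype_lt (x := b) (not_not.2 hrb)) C₂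
    (hDs.submatrix _ _) (fun t => (hDh t).submatrix _) (ht2 _ (isOneSided_nhdsGT t₀) hr)
    (ht2 _ (isOneSided_nhdsLT t₀) hl)
  have hne : ∀ i j, d₁ i t₀ ≠ d₂ j t₀ := fun i j => by
    have e1 := hlt.self_of_nhds _ ((hf₁.eventually.self_of_nhds.isRoot_iff _).2 ⟨i, rfl⟩)
    have e2 := hgt.self_of_nhds _ ((hf₂.eventually.self_of_nhds.isRoot_iff _).2 ⟨j, rfl⟩)
    exact (e2.trans e1).ne'
  exact ⟨_, _, (IsLocalEigenframe.of_submatrix e (hf₁.fromBlocks hf₂ hblocks hne)).conj hU hUu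
    (Filter.Eventually.of_forall fun _ => rfl)⟩

theorem exists_isLocalEigenframe (t₀ : ℝ) (m : ℕ) :
    ∀ (ι : Type) [Fintype ι] [DecidableEq ι], Fintype.card ι = m →
      ∀ B : ℝ → Matrix ι ι ℂ, SmoothMatrix B → (∀ t, (B t).IsHermitian) →
        HasTameSpectrum B t₀ (𝓝[>] t₀) → HasTameSpectrum B t₀ (𝓝[<] t₀) →
        ∃ d V, IsLocalEigenframe B t₀ d V := by
  induction m using Nat.strong_induction_on with
  | _ m ih =>
  intro ι _ _ hm B hB hBh hr hl
  -- Removing the trace ensures that the leading coefficient at `t₀`, if there is one, is not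
  -- scalar.
  set τ : ℝ → ℝ := fun t => (∑ i, (B t i i).re) / Fintype.card ι with hτ
  have hτs : ContDiff ℝ ∞ τ :=
    (ContDiff.sum fun i _ => Complex.reCLM.contDiff.comp (hB i i)).div_const _
  have hfs : ∀ k : ι × ι, ContDiff ℝ ∞ fun t => (B t - (τ t : ℂ) • (1 : Matrix ι ι ℂ)) k.1 k.2 := by
    intro k
    simp only [Matrix.sub_apply, Matrix.smul_apply, smul_eq_mul]
    exact (hB _ _).sub ((Complex.ofRealCLM.contDiff.comp hτs).mul contDiff_const)
  rcases forall_isBigO_or_exists_eq_pow_smul _ hfs t₀ with hflat | ⟨N, g, hg, hfg, ⟨k, hk⟩⟩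
  · exact ⟨_, _, isLocalEigenframe_one_of_isBigO hBh hr hl hτs (fun _ => rfl)
      fun i j N => hflat (i, j) N⟩
  set C : ℝ → Matrix ι ι ℂ := fun t => Matrix.of fun i j => g (i, j) t with hC
  have hCs : SmoothMatrix C := fun i j => hg (i, j)
  have hBC : ∀ t, B t = (τ t : ℂ) • (1 : Matrix ι ι ℂ) + (((t - t₀) ^ N : ℝ) : ℂ) • C t := by
    intro t
    rw [← sub_eq_iff_eq_add']
    ext i j
    rw [hfg (i, j) t]
    simp [hC]
  -- The quotient `C` inherits identities from `B - τ • 1` off `t₀` by cancellation, and at `t₀` by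
  -- density.
  have hext : ∀ f₁ f₂ : ℝ → ℂ, Continuous f₁ → Continuous f₂ →
      (∀ t, ((t - t₀) ^ N : ℝ) • f₁ t = ((t - t₀) ^ N : ℝ) • f₂ t) → f₁ = f₂ := by
    intro f₁ f₂ h₁ h₂ h
    refine Continuous.ext_on (dense_compl_singleton t₀) h₁ h₂ fun t ht => ?_
    exact smul_right_injective ℂ (pow_ne_zero N (sub_ne_zero.2 ht)) (h t)
  have hCh : ∀ t, (C t).IsHermitian := by
    intro t
    ext i j
    refine congrFun (hext (fun t => star (g (j, i) t)) (g (i, j)) (hg _).continuous.star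
      (hg _).continuous fun t => ?_) t
    have h1 := hfg (j, i) t
    have h2 := hfg (i, j) t
    rw [← h2, ← star_trivial ((t - t₀) ^ N), ← star_smul, ← h1]
    have h3 : (B t - (τ t : ℂ) • (1 : Matrix ι ι ℂ)).IsHermitian := by
      refine (hBh t).sub ?_
      ext i j
      by_cases hij : i = j
      · simp [hij]
      · simp [hij, Ne.symm hij]
    exact h3.apply i j
  have hCtr : ∑ i, C t₀ i i = 0 := by
    refine congrFun (hext (fun t => ∑ i, C t i i) (fun _ => 0)
      (continuous_finsetSum _ fun i _ => (hCs i i).continuous) continuous_const fun t => ?_) t₀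
    rw [smul_zero, Finset.smul_sum]
    calc ∑ i, ((t - t₀) ^ N) • C t i i
        = ∑ i, (B t - (τ t : ℂ) • (1 : Matrix ι ι ℂ)) i i :=
          Finset.sum_congr rfl fun i _ => (hfg (i, i) t).symm
      _ = ∑ i, ((B t i i).re : ℂ) - Fintype.card ι * (τ t : ℂ) := by
          simp [fun i => Complex.conj_eq_iff_re.1 ((hBh t).apply i i)]
      _ = 0 := by
          have : (Fintype.card ι : ℂ) ≠ 0 := by
            have : Fintype.card ι ≠ 0 := @Fintype.card_ne_zero _ _ ⟨k.1⟩
            exact_mod_cast this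
          simp only [hτ]
          push_cast
          field_simp
          ring
  obtain ⟨d, W, hW⟩ := (hCh t₀).exists_isEigenframe
  set C' : ℝ → Matrix ι ι ℂ := fun t => Wᴴ * (C t * W) with hC'
  have hC's : SmoothMatrix C' := (SmoothMatrix.const _).mul (hCs.mul (SmoothMatrix.const _))
  have hC'h : ∀ t, (C' t).IsHermitian := fun t => by
    simp only [hC', ← Matrix.mul_assoc]
    exact Matrix.isHermitian_conjTranspose_mul_mul _ (hCh t)
  have hC'0 : C' t₀ = Matrix.diagonal fun i => (d i : ℂ) := by
    simp only [hC', hW.2]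
    rw [← Matrix.mul_assoc, hW.1, Matrix.one_mul]
  have htame : ∀ l, IsOneSided t₀ l → HasTameSpectrum B t₀ l → HasTameSpectrum C' t₀ l :=
    fun l hl hB => (hB.affine hl hτs.continuous hBC).congr
      (Filter.Eventually.of_forall fun t => charpoly_conjTranspose_mul_mul hW.1 _)
  -- If all eigenvalues of `C t₀` were equal, trace zero would give `C t₀ = 0`, against the choice
  -- of `N`.
  have hd : ∃ a b, d a < d b := by
    by_contra! hd
    have hd' : ∀ i, d i = d k.1 := fun i => le_antisymm (hd k.1 i) (hd i k.1)
    have h1 : C t₀ = (d k.1 : ℂ) • (1 : Matrix ι ι ℂ) := by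
      have h2 := congrArg (· * Wᴴ) hW.2
      have h3 : (Matrix.diagonal fun i => (d i : ℂ)) = (d k.1 : ℂ) • (1 : Matrix ι ι ℂ) := by
        simp [hd', Matrix.smul_one_eq_diagonal]
      simpa [h3, Matrix.mul_assoc, mul_eq_one_comm.1 hW.1] using h2
    have hcard : (Fintype.card ι : ℂ) ≠ 0 := by
      have : Fintype.card ι ≠ 0 := @Fintype.card_ne_zero _ _ ⟨k.1⟩
      exact_mod_cast this
    have h2 : (d k.1 : ℂ) = 0 := by
      simpa [h1, hcard] using hCtr
    refine hk ?_
    have h3 : C t₀ k.1 k.2 = 0 := by simp [h1, h2]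
    exact h3
  obtain ⟨a, b, hab⟩ := hd
  obtain ⟨d', V', hV'⟩ := exists_isLocalEigenframe_of_diagonal hC's hC'h hC'0 hab
    (htame _ (isOneSided_nhdsGT t₀) hr) (htame _ (isOneSided_nhdsLT t₀) hl)
    fun κ _ _ hκ => ih _ (hm ▸ hκ) κ rfl
  exact ⟨_, _, (hV'.conj (SmoothMatrix.const W) (Filter.Eventually.of_forall fun _ => hW.1)
    (Filter.Eventually.of_forall fun _ => rfl)).affine hτs hBC⟩

end Existence

/-! ### Rigidity of smooth eigenvalues -/

section Uniqueness

variable {ι : Type*} [Fintype ι] [DecidableEq ι]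

theorem SeparatedAt.eventuallyEq_or_eventually_ne {t₀ : ℝ} {f : ℝ → ℝ} (hf : SeparatedAt t₀ f) :
    f =ᶠ[𝓝 t₀] 0 ∨ ∀ᶠ t in 𝓝[≠] t₀, f t ≠ 0 := by
  refine hf.imp_right fun ⟨N, hN⟩ => ?_
  obtain ⟨c, hc⟩ := hN.bound
  filter_upwards [nhdsWithin_le_nhds hc, self_mem_nhdsWithin] with t ht hne h0
  have h1 : ‖(t - t₀) ^ N‖ ≤ 0 := by
    rw [h0] at ht
    simpa using ht
  exact pow_ne_zero N (sub_ne_zero.2 hne) (norm_le_zero_iff.1 h1)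

/-- A finite order of vanishing would make `f` nonzero at points of that side close to `t₀`. The
conclusion is two-sided: flatness passes across `t₀`. -/
theorem isBigO_of_eventuallyEq_zero {f : ℝ → ℝ} (hf : ContDiff ℝ ∞ f) {t₀ : ℝ} {l : Filter ℝ}
    (hl : IsOneSided t₀ l) (h : f =ᶠ[l] 0) (N : ℕ) : f =O[𝓝 t₀] fun t => (t - t₀) ^ N := by
  rcases forall_isBigO_or_exists_eq_pow_smul (fun _ : Unit => f) (fun _ => hf) t₀ with
    h1 | ⟨M, g, hg, hfg, k, hk⟩
  · exact h1 () N
  · exfalso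
    have hneBot := hl.neBot
    have h2 : ∀ᶠ t in l, g k t ≠ 0 :=
      hl.le_nhds ((hg k).continuous.continuousAt.eventually_ne hk)
    obtain ⟨t, ht, ht2, hne⟩ := (h.and (h2.and hl.eventually_ne)).exists
    rw [hfg k t] at ht
    exact (smul_ne_zero (pow_ne_zero M (sub_ne_zero.2 hne)) ht2) ht

/-- On a small interval beside `t₀`, eigenvalues with different germs never meet. The closed sets
where `f` equals one germ class or another are then disjoint and cover the interval, so
connectedness leaves only one. -/
theorem IsLocalEigenframe.exists_eventuallyEq_oneSided {A : ℝ → Matrix ι ι ℂ} {t₀ : ℝ}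
    {d : ι → ℝ → ℝ} {V : ℝ → Matrix ι ι ℂ} (h : IsLocalEigenframe A t₀ d V) {f : ℝ → ℝ}
    (hf : Continuous f) (hroot : ∀ᶠ t in 𝓝 t₀, (A t).charpoly.IsRoot (f t : ℂ)) {l : Filter ℝ}
    (hl : IsOneSided t₀ l) : ∃ k, f =ᶠ[l] d k := by
  classical
  have hneBot := hl.neBot
  have h1 : ∀ᶠ t in l, ∀ i j, d i =ᶠ[𝓝 t₀] d j ∧ d i t = d j t ∨ d i t ≠ d j t := by
    refine Filter.eventually_all.2 fun i => Filter.eventually_all.2 fun j => ?_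
    rcases (h.separated i j).eventuallyEq_or_eventually_ne with hij | hij
    · filter_upwards [hl.le_nhds hij] with t ht
      exact Or.inl ⟨hij.mono fun t ht => sub_eq_zero.1 ht, sub_eq_zero.1 ht⟩
    · filter_upwards [hl.le_nhdsNE hij] with t ht
      exact Or.inr (sub_ne_zero.1 ht)
  have h2 : ∀ᶠ t in l, ∃ i, d i t = f t := by
    filter_upwards [hl.le_nhds h.eventually, hl.le_nhds hroot] with t ht hr
    exact (ht.isRoot_iff _).1 hr
  have h1' : ∀ᶠ t in l, ∀ i j, ¬ d i =ᶠ[𝓝 t₀] d j → d i t ≠ d j t :=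
    h1.mono fun t ht i j hij => (ht i j).resolve_left fun h => hij h.1
  have h1'' : ∀ᶠ t in l, ∀ i j, d i =ᶠ[𝓝 t₀] d j → d i t = d j t :=
    Filter.eventually_all.2 fun i => Filter.eventually_all.2 fun j => by
      by_cases hij : d i =ᶠ[𝓝 t₀] d j
      · filter_upwards [hl.le_nhds hij] with t ht _ using ht
      · exact Filter.Eventually.of_forall fun t h => absurd h hij
  obtain ⟨u, hu, hus, hc⟩ := hl.exists_preconnected _ (h1'.and (h1''.and h2))
  obtain ⟨a, ha⟩ := Filter.nonempty_of_mem hu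
  obtain ⟨k, hk⟩ := (hus ha).2.2
  refine ⟨k, Filter.mem_of_superset hu fun b hb => ?_⟩
  by_contra hne
  have hcd : ∀ i, IsClosed {t | f t = d i t} := fun i =>
    isClosed_eq hf (h.smooth_left i).continuous
  have hc2 : IsClosed (⋃ i : {i // ¬ d k =ᶠ[𝓝 t₀] d i}, {t | f t = d i t}) :=
    isClosed_iUnion_of_finite fun i => hcd i
  have hmem : ∀ t ∈ u, ¬ f t = d k t →
      t ∈ ⋃ i : {i // ¬ d k =ᶠ[𝓝 t₀] d i}, {t | f t = d i t} := by
    intro t ht hne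
    obtain ⟨i, hi⟩ := (hus ht).2.2
    exact Set.mem_iUnion.2 ⟨⟨i, fun h => hne (by rw [(hus ht).2.1 k i h, hi])⟩, hi.symm⟩
  obtain ⟨c, hcu, hck, hci⟩ := isPreconnected_closed_iff.1 hc _ _ (hcd k) hc2
    (fun t ht => or_iff_not_imp_left.2 (hmem t ht)) ⟨a, ha, hk.symm⟩ ⟨b, hb, hmem b hb hne⟩
  obtain ⟨⟨i, hi⟩, hci⟩ := Set.mem_iUnion.1 hci
  exact (hus hcu).1 k i hi ((Eq.symm hck).trans hci)

/-- A smooth eigenvalue is one of the eigenvalues of a local eigenframe. -/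
theorem IsLocalEigenframe.exists_eventuallyEq {A : ℝ → Matrix ι ι ℂ} {t₀ : ℝ}
    {d : ι → ℝ → ℝ} {V : ℝ → Matrix ι ι ℂ} (h : IsLocalEigenframe A t₀ d V) {f : ℝ → ℝ}
    (hf : ContDiff ℝ ∞ f) (hroot : ∀ᶠ t in 𝓝 t₀, (A t).charpoly.IsRoot (f t : ℂ)) :
    ∃ k, f =ᶠ[𝓝 t₀] d k := by
  obtain ⟨k, hk⟩ := h.exists_eventuallyEq_oneSided hf.continuous hroot (isOneSided_nhdsGT t₀)
  obtain ⟨j, hj⟩ := h.exists_eventuallyEq_oneSided hf.continuous hroot (isOneSided_nhdsLT t₀)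
  refine ⟨k, ?_⟩
  -- Since `f - d k` vanishes on the right it is flat at `t₀`; on the left it equals `d j - d k`,
  -- which therefore cannot have finite order.
  have hjk : d j =ᶠ[𝓝 t₀] d k := by
    rcases h.separated j k with h1 | ⟨N, hN⟩
    · exact h1.mono fun t ht => sub_eq_zero.1 ht
    · exfalso
      have h2 : (fun t => f t - d k t) =O[𝓝 t₀] fun t => (t - t₀) ^ (N + 1) :=
        isBigO_of_eventuallyEq_zero (hf.sub (h.smooth_left k)) (isOneSided_nhdsGT t₀)
          (hk.mono fun t ht => sub_eq_zero.2 ht) (N + 1)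
      have h3 : (fun t => d j t - d k t) =O[𝓝[<] t₀] fun t => (t - t₀) ^ (N + 1) := by
        refine (h2.mono nhdsWithin_le_nhds).congr' ?_ Filter.EventuallyEq.rfl
        filter_upwards [hj] with t ht
        rw [ht]
      have h4 : (fun t => (t - t₀) ^ (N + 1)) =o[𝓝[<] t₀] fun t => (t - t₀) ^ N := by
        have : Continuous fun t : ℝ => t - t₀ := by fun_prop
        have h5 : Filter.Tendsto (fun t => t - t₀) (𝓝 t₀) (𝓝 0) := by
          simpa using this.tendsto t₀
        have h6 := ((Asymptotics.isLittleO_one_iff ℝ).2 (h5.mono_left nhdsWithin_le_nhds)).mul_isBigO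
          (Asymptotics.isBigO_refl (fun t => (t - t₀) ^ N) (𝓝[<] t₀))
        simpa [pow_succ'] using h6
      refine Asymptotics.isLittleO_irrefl ?_
        (((hN.mono nhdsWithin_le_nhds).trans h3).trans_isLittleO h4)
      refine Filter.Eventually.frequently ?_
      filter_upwards [self_mem_nhdsWithin] with t ht
      exact pow_ne_zero N (sub_ne_zero.2 (ne_of_lt ht))
  have hne : ∀ᶠ t in 𝓝[≠] t₀, f t = d k t := by
    rw [← nhdsLT_sup_nhdsGT]
    refine Filter.eventually_sup.2 ⟨?_, hk⟩
    filter_upwards [hj, nhdsWithin_le_nhds hjk] with t h1 h2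
    rw [h1, h2]
  rw [← nhdsNE_sup_pure]
  refine Filter.eventually_sup.2 ⟨hne, Filter.eventually_pure.2 ?_⟩
  exact tendsto_nhds_unique_of_eventuallyEq
    (hf.continuous.continuousAt.tendsto.mono_left nhdsWithin_le_nhds)
    ((h.smooth_left k).continuous.continuousAt.tendsto.mono_left nhdsWithin_le_nhds) hne

/-- At every point, the curve `A` has a local eigenframe. -/
def HasLocalEigenframes (A : ℝ → Matrix ι ι ℂ) : Prop :=
  ∀ t₀, ∃ d V, IsLocalEigenframe A t₀ d V

theorem HasLocalEigenframes.eventuallyEq_or_eventually_ne {A : ℝ → Matrix ι ι ℂ}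
    (hA : HasLocalEigenframes A) {t₀ : ℝ} {f g : ℝ → ℝ} (hf : ContDiff ℝ ∞ f)
    (hg : ContDiff ℝ ∞ g) (hfr : ∀ᶠ t in 𝓝 t₀, (A t).charpoly.IsRoot (f t : ℂ))
    (hgr : ∀ᶠ t in 𝓝 t₀, (A t).charpoly.IsRoot (g t : ℂ)) :
    f =ᶠ[𝓝 t₀] g ∨ ∀ᶠ t in 𝓝[≠] t₀, f t ≠ g t := by
  obtain ⟨d, V, h⟩ := hA t₀
  obtain ⟨j, hj⟩ := h.exists_eventuallyEq hf hfr
  obtain ⟨k, hk⟩ := h.exists_eventuallyEq hg hgr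
  rcases (h.separated j k).eventuallyEq_or_eventually_ne with h1 | h1
  · left
    filter_upwards [hj, hk, h1] with t hj hk h1
    rw [hj, hk, sub_eq_zero.1 h1]
  · right
    filter_upwards [nhdsWithin_le_nhds hj, nhdsWithin_le_nhds hk, h1] with t hj hk h1
    rw [hj, hk]
    exact sub_ne_zero.1 h1

/-- Smooth eigenvalues satisfy an identity principle. -/
theorem HasLocalEigenframes.eventuallyEq_of_isPreconnected {A : ℝ → Matrix ι ι ℂ}
    (hA : HasLocalEigenframes A) {T : Set ℝ} (hT : IsPreconnected T) {f g : ℝ → ℝ}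
    (hf : ContDiff ℝ ∞ f) (hg : ContDiff ℝ ∞ g)
    (hfr : ∀ t₀ ∈ T, ∀ᶠ t in 𝓝 t₀, (A t).charpoly.IsRoot (f t : ℂ))
    (hgr : ∀ t₀ ∈ T, ∀ᶠ t in 𝓝 t₀, (A t).charpoly.IsRoot (g t : ℂ)) {b : ℝ} (hb : b ∈ T)
    (hfg : f =ᶠ[𝓝 b] g) {t : ℝ} (ht : t ∈ T) : f =ᶠ[𝓝 t] g := by
  -- Equality of germs is locally constant along `T`, because `f` and `g` coincide near `x` or
  -- differ throughout a punctured neighborhood.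
  have key : ∀ x ∈ T, ∀ᶠ y in 𝓝[T] x, f =ᶠ[𝓝 x] g ↔ f =ᶠ[𝓝 y] g := by
    intro x hx
    refine nhdsWithin_le_nhds ?_
    rcases hA.eventuallyEq_or_eventually_ne hf hg (hfr x hx) (hgr x hx) with h | h
    · filter_upwards [eventually_eventually_nhds.2 h] with y hy
      exact ⟨fun _ => hy, fun _ => h⟩
    · filter_upwards [eventually_nhdsWithin_iff.1 h] with y hy
      by_cases hxy : y = x
      · rw [hxy]
      · refine iff_of_false (fun h' => ?_) fun h' => hy hxy h'.self_of_nhds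
        obtain ⟨z, hz, hz'⟩ := (h.and (nhdsWithin_le_nhds h')).exists
        exact hz hz'
  have h1 := hT.induction₂' (fun x y => f =ᶠ[𝓝 x] g ↔ f =ᶠ[𝓝 y] g)
    (fun x hx => (key x hx).mono fun y hy => ⟨hy, hy.symm⟩)
    (fun _ _ _ _ _ _ h1 h2 => h1.trans h2) hb ht
  exact h1.1 hfg

end Uniqueness

/-! ### Matching of eigenvalues with multiplicity, and pasting at a point -/

theorem exists_perm_of_map_univ_val_eq {ι α : Type*} [Fintype ι] {f g : ι → α}
    (h : Finset.univ.val.map f = Finset.univ.val.map g) :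
    ∃ σ : Equiv.Perm ι, ∀ i, g (σ i) = f i := by
  classical
  have hcard : ∀ a, Fintype.card {i // f i = a} = Fintype.card {i // g i = a} := by
    intro a
    have h1 := congrArg (Multiset.count a) h
    rw [Multiset.count_map, Multiset.count_map] at h1
    rw [Fintype.card_subtype, Fintype.card_subtype]
    simp only [eq_comm (a := a)] at h1
    exact h1
  refine ⟨(Equiv.sigmaFiberEquiv f).symm.trans ((Equiv.sigmaCongrRight fun a =>
    Fintype.equivOfCardEq (hcard a)).trans (Equiv.sigmaFiberEquiv g)), fun i => ?_⟩
  exact (Fintype.equivOfCardEq (hcard (f i)) ⟨i, rfl⟩).2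

theorem exists_perm_of_prod_X_sub_C_eq {ι : Type*} [Fintype ι] {d e : ι → ℝ}
    (h : ∏ i, (Polynomial.X - Polynomial.C (d i : ℂ)) =
      ∏ i, (Polynomial.X - Polynomial.C (e i : ℂ))) :
    ∃ σ : Equiv.Perm ι, ∀ i, e (σ i) = d i := by
  have h1 : ∀ d : ι → ℝ, (∏ i, (Polynomial.X - Polynomial.C (d i : ℂ))).roots =
      Finset.univ.val.map fun i => (d i : ℂ) := by
    intro d
    rw [← Polynomial.roots_multiset_prod_X_sub_C (Finset.univ.val.map fun i => (d i : ℂ)),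
      Multiset.map_map]
    rfl
  obtain ⟨σ, hσ⟩ := exists_perm_of_map_univ_val_eq ((h1 d).symm.trans ((congrArg _ h).trans (h1 e)))
  exact ⟨σ, fun i => by exact_mod_cast hσ i⟩

theorem ContDiff.piecewise_le {E : Type*} [NormedAddCommGroup E] [NormedSpace ℝ E] {f g : ℝ → E}
    (hf : ContDiff ℝ ∞ f) (hg : ContDiff ℝ ∞ g) {b : ℝ} (h : f =ᶠ[𝓝 b] g) :
    ContDiff ℝ ∞ fun t => if t ≤ b then f t else g t := by
  refine contDiff_iff_contDiffAt.2 fun t => ?_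
  rcases lt_trichotomy t b with ht | rfl | ht
  · refine hf.contDiffAt.congr_of_eventuallyEq ?_
    filter_upwards [gt_mem_nhds ht] with s hs
    rw [if_pos hs.le]
  · refine hf.contDiffAt.congr_of_eventuallyEq ?_
    filter_upwards [h] with s hs
    rw [← hs, ite_self]
  · refine hg.contDiffAt.congr_of_eventuallyEq ?_
    filter_upwards [lt_mem_nhds ht] with s hs
    rw [if_neg (not_le.2 hs)]

/-! ### Gluing of eigenframes -/

section Gluing

variable {ι : Type*} [Fintype ι] [DecidableEq ι]

/-- Smooth eigenvalues `d` and smooth orthonormal eigenvectors, the columns of `V`, of the curve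
`A` on a neighborhood of `S`. -/
structure IsEigenframeOn (A : ℝ → Matrix ι ι ℂ) (S : Set ℝ) (d : ι → ℝ → ℝ)
    (V : ℝ → Matrix ι ι ℂ) : Prop where
  smooth_left : ∀ i, ContDiff ℝ ∞ (d i)
  smooth_right : SmoothMatrix V
  eventually : ∀ t₀ ∈ S, ∀ᶠ t in 𝓝 t₀, IsEigenframe (A t) (fun i => d i t) (V t)

namespace IsEigenframeOn

variable {A : ℝ → Matrix ι ι ℂ} {S T : Set ℝ} {d e : ι → ℝ → ℝ} {V W : ℝ → Matrix ι ι ℂ}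

theorem mono (h : IsEigenframeOn A T d V) (hST : S ⊆ T) : IsEigenframeOn A S d V :=
  ⟨h.smooth_left, h.smooth_right, fun t ht => h.eventually t (hST ht)⟩

theorem eventually_isRoot (h : IsEigenframeOn A S d V) {t₀ : ℝ} (ht₀ : t₀ ∈ S) (i : ι) :
    ∀ᶠ t in 𝓝 t₀, (A t).charpoly.IsRoot (d i t : ℂ) :=
  (h.eventually t₀ ht₀).mono fun _ ht => (ht.isRoot_iff _).2 ⟨i, rfl⟩

theorem perm (h : IsEigenframeOn A S d V) (σ : Equiv.Perm ι) :
    IsEigenframeOn A S (fun i => d (σ i)) fun t => (V t).submatrix id σ where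
  smooth_left i := h.smooth_left _
  smooth_right i j := h.smooth_right _ _
  eventually t₀ ht₀ := by
    filter_upwards [h.eventually t₀ ht₀] with t ht
    constructor
    · rw [Matrix.conjTranspose_submatrix, ← Matrix.submatrix_mul _ _ _ _ _ Function.bijective_id,
        ht.1, Matrix.submatrix_one_equiv]
    · have := congrArg (fun M : Matrix ι ι ℂ => M.submatrix id σ) ht.2
      ext i j
      have := congrFun (congrFun this i) j
      simpa [Matrix.mul_apply, Matrix.diagonal_apply] using this

/-- At a single point `s ≠ b` close to `b`, equal values already force equal germs at `b`; so it
suffices to match the two lists of eigenvalues of `A s`. -/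
theorem exists_perm_eventuallyEq (hA : HasLocalEigenframes A) {b : ℝ}
    (h : IsEigenframeOn A {b} d V) (h' : IsEigenframeOn A {b} e W) :
    ∃ σ : Equiv.Perm ι, ∀ i, e (σ i) =ᶠ[𝓝 b] d i := by
  have h1 : ∀ᶠ t in 𝓝[≠] b, ∀ i j, e j t = d i t → e j =ᶠ[𝓝 b] d i := by
    refine Filter.eventually_all.2 fun i => Filter.eventually_all.2 fun j => ?_
    rcases hA.eventuallyEq_or_eventually_ne (h'.smooth_left j) (h.smooth_left i)
      (h'.eventually_isRoot rfl j) (h.eventually_isRoot rfl i) with h2 | h2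
    · exact Filter.Eventually.of_forall fun t _ => h2
    · exact h2.mono fun t ht heq => absurd heq ht
  obtain ⟨s, hs, hsd, hse⟩ := (h1.and (nhdsWithin_le_nhds
    ((h.eventually b rfl).and (h'.eventually b rfl)))).exists
  obtain ⟨σ, hσ⟩ := exists_perm_of_prod_X_sub_C_eq (hsd.charpoly_eq.symm.trans hse.charpoly_eq)
  exact ⟨σ, fun i => hs _ _ (hσ i)⟩

/-- The transition matrix between two eigenframes with the same eigenvalues preserves the
eigenspaces. -/
theorem eventually_transition_eq_zero (hA : HasLocalEigenframes A) {b : ℝ}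
    (h : IsEigenframeOn A {b} d V) (h' : IsEigenframeOn A {b} e W)
    (hde : ∀ i, e i =ᶠ[𝓝 b] d i) {i j : ι} (hij : ¬ e i =ᶠ[𝓝 b] e j) :
    ∀ᶠ t in 𝓝 b, ((W t)ᴴ * V t) i j = 0 := by
  have hne := (hA.eventuallyEq_or_eventually_ne (h'.smooth_left i) (h'.smooth_left j)
      (h'.eventually_isRoot rfl i) (h'.eventually_isRoot rfl j)).resolve_left hij
  -- Both frames diagonalize `A t` to the same diagonal matrix, so `Wᴴ * V` commutes with it and its
  -- entries between distinct eigenvalues vanish. The point `b` is recovered by continuity.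
  have h1 : ∀ᶠ t in 𝓝[≠] b, ((W t)ᴴ * V t) i j = 0 := by
    filter_upwards [hne, nhdsWithin_le_nhds (h.eventually b rfl),
      nhdsWithin_le_nhds (h'.eventually b rfl),
      nhdsWithin_le_nhds (Filter.eventually_all.2 hde), self_mem_nhdsWithin] with t hne hV hW hd htb
    have e1 : A t = W t * (Matrix.diagonal fun i => (e i t : ℂ)) * (W t)ᴴ := by
      rw [← hW.2, Matrix.mul_assoc, mul_eq_one_comm.1 hW.1, Matrix.mul_one]
    have e2 : (Matrix.diagonal fun i => (e i t : ℂ)) * ((W t)ᴴ * V t) =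
        ((W t)ᴴ * V t) * Matrix.diagonal fun i => (e i t : ℂ) := by
      have e3 : (fun i => (e i t : ℂ)) = fun i => (d i t : ℂ) := by
        funext i; rw [hd i]
      have e4 := hV.2
      rw [e1] at e4
      calc _ = (W t)ᴴ * (W t * (Matrix.diagonal fun i => (e i t : ℂ)) * (W t)ᴴ * V t) := by
            simp only [← Matrix.mul_assoc, hW.1, Matrix.one_mul]
        _ = _ := by rw [e4, e3, Matrix.mul_assoc]
    have e5 := congrFun (congrFun e2 i) j
    rw [Matrix.diagonal_mul, Matrix.mul_diagonal] at e5
    have e6 : ((e i t : ℂ) - e j t) * ((W t)ᴴ * V t) i j = 0 := by linear_combination e5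
    exact (mul_eq_zero.1 e6).resolve_left (sub_ne_zero.2 (by exact_mod_cast hne))
  have hc : Continuous fun t => ((W t)ᴴ * V t) i j :=
    (h'.smooth_right.conjTranspose.mul h.smooth_right i j).continuous
  rw [← nhdsNE_sup_pure]
  refine Filter.eventually_sup.2 ⟨h1, Filter.eventually_pure.2 ?_⟩
  exact tendsto_nhds_unique_of_eventuallyEq
    (hc.continuousAt.tendsto.mono_left nhdsWithin_le_nhds) tendsto_const_nhds h1

/-- An eigenframe near a connected set can be changed so as to agree with a given one near a point
of that set. -/
theorem exists_eventuallyEq (hA : HasLocalEigenframes A) (hT : IsPreconnected T) {b : ℝ}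
    (hb : b ∈ T) (h : IsEigenframeOn A {b} d V) (h' : IsEigenframeOn A T e W) :
    ∃ e' W', IsEigenframeOn A T e' W' ∧ (∀ i, e' i =ᶠ[𝓝 b] d i) ∧ W' =ᶠ[𝓝 b] V := by
  obtain ⟨σ, hσ⟩ := h.exists_perm_eventuallyEq hA (h'.mono (Set.singleton_subset_iff.2 hb))
  replace h' := h'.perm σ
  set e₁ : ι → ℝ → ℝ := fun i => e (σ i)
  set W₁ : ℝ → Matrix ι ι ℂ := fun t => (W t).submatrix id σ
  have h'b := h'.mono (Set.singleton_subset_iff.2 hb)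
  have hU0 : ∀ᶠ t in 𝓝 b, ∀ i j, ¬ e₁ i =ᶠ[𝓝 b] e₁ j → ((W₁ t)ᴴ * V t) i j = 0 := by
    refine Filter.eventually_all.2 fun i => Filter.eventually_all.2 fun j => ?_
    by_cases hij : e₁ i =ᶠ[𝓝 b] e₁ j
    · exact Filter.Eventually.of_forall fun t h => absurd hij h
    · filter_upwards [h.eventually_transition_eq_zero hA h'b hσ hij] with t ht _ using ht
  -- Evaluating the transition matrix at `φ t` keeps it unitary, with the same forced zeros, for all
  -- `t`, including where `V` is not a frame.
  obtain ⟨φ, hφ, hφb, hφm⟩ := exists_smooth_reparametrization b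
    (hU0.and ((h.eventually b rfl).and (h'b.eventually b rfl)))
  set U : ℝ → Matrix ι ι ℂ := fun t => (W₁ (φ t))ᴴ * V (φ t) with hU
  have hUu : ∀ t, (U t)ᴴ * U t = 1 := by
    intro t
    obtain ⟨-, hV, hW⟩ := hφm t
    rw [hU, Matrix.conjTranspose_mul, Matrix.conjTranspose_conjTranspose, Matrix.mul_assoc,
      ← Matrix.mul_assoc (W₁ (φ t)), mul_eq_one_comm.1 hW.1, Matrix.one_mul, hV.1]
  refine ⟨e₁, fun t => W₁ t * U t, ⟨h'.smooth_left, h'.smooth_right.mul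
    ((h'.smooth_right.comp hφ).conjTranspose.mul (h.smooth_right.comp hφ)), ?_⟩, hσ, ?_⟩
  · intro t₀ ht₀
    -- The identity principle carries equalities of eigenvalues from `b` to all of `T`; hence `U t`
    -- commutes with the diagonal matrix of eigenvalues there.
    have h2 : ∀ᶠ t in 𝓝 t₀, ∀ i j, e₁ i =ᶠ[𝓝 b] e₁ j → e₁ i t = e₁ j t := by
      refine Filter.eventually_all.2 fun i => Filter.eventually_all.2 fun j => ?_
      by_cases hij : e₁ i =ᶠ[𝓝 b] e₁ j
      · filter_upwards [hA.eventuallyEq_of_isPreconnected hT (h'.smooth_left i) (h'.smooth_left j)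
          (fun t ht => h'.eventually_isRoot ht i) (fun t ht => h'.eventually_isRoot ht j) hb hij
          ht₀] with t ht _ using ht
      · exact Filter.Eventually.of_forall fun t h => absurd h hij
    filter_upwards [h'.eventually t₀ ht₀, h2] with t ht h2
    constructor
    · rw [Matrix.conjTranspose_mul, Matrix.mul_assoc, ← Matrix.mul_assoc _ (W₁ t), ht.1,
        Matrix.one_mul, hUu]
    · have h3 : (Matrix.diagonal fun i => (e₁ i t : ℂ)) * U t =
          U t * Matrix.diagonal fun i => (e₁ i t : ℂ) := by
        ext i j
        rw [Matrix.diagonal_mul, Matrix.mul_diagonal]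
        by_cases hij : e₁ i =ᶠ[𝓝 b] e₁ j
        · rw [h2 i j hij, mul_comm]
        · have : U t i j = 0 := (hφm t).1 i j hij
          rw [this, mul_zero, zero_mul]
      rw [← Matrix.mul_assoc, ht.2, Matrix.mul_assoc, h3]
      exact (Matrix.mul_assoc _ _ _).symm
  · filter_upwards [hφb, h'b.eventually b rfl] with t ht hW
    simp only [hU, ht]
    rw [← Matrix.mul_assoc, mul_eq_one_comm.1 hW.1, Matrix.one_mul]

theorem exists_glue (hA : HasLocalEigenframes A) (hT : IsPreconnected T) {b : ℝ}
    (hbS : b ∈ S) (hbT : b ∈ T) (h : IsEigenframeOn A S d V) (h' : IsEigenframeOn A T e W) :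
    ∃ d' V', IsEigenframeOn A (S ∩ Set.Iic b ∪ T ∩ Set.Ici b) d' V' ∧
      ∀ t ≤ b, (∀ i, d' i t = d i t) ∧ V' t = V t := by
  have hb := h.mono (Set.singleton_subset_iff.2 hbS)
  obtain ⟨e', W', h', hd, hV⟩ := hb.exists_eventuallyEq hA hT hbT h'
  set d₁ : ι → ℝ → ℝ := fun i t => if t ≤ b then d i t else e' i t with hd₁
  set V₁ : ℝ → Matrix ι ι ℂ := fun t => if t ≤ b then V t else W' t with hV₁
  have hleft : ∀ t₀ ≤ b, ∀ᶠ t in 𝓝 t₀, (∀ i, d₁ i t = d i t) ∧ V₁ t = V t := by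
    intro t₀ ht₀
    rcases ht₀.lt_or_eq with ht₀ | rfl
    · filter_upwards [gt_mem_nhds ht₀] with t ht
      simp [hd₁, hV₁, le_of_lt ht]
    · filter_upwards [Filter.eventually_all.2 hd, hV] with t hd hV
      simp [hd₁, hV₁, hd, hV]
  have hright : ∀ t₀, b ≤ t₀ → ∀ᶠ t in 𝓝 t₀, (∀ i, d₁ i t = e' i t) ∧ V₁ t = W' t := by
    intro t₀ ht₀
    rcases ht₀.lt_or_eq with ht₀ | rfl
    · filter_upwards [lt_mem_nhds ht₀] with t ht
      simp [hd₁, hV₁, not_le.2 ht]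
    · filter_upwards [Filter.eventually_all.2 hd, hV] with t hd hV
      simp [hd₁, hV₁, hd, hV]
  refine ⟨d₁, V₁, ⟨fun i => (h.smooth_left i).piecewise_le (h'.smooth_left i) (hd i).symm,
    fun i j => ?_, ?_⟩, fun t ht => by simp [hd₁, hV₁, ht]⟩
  · have := (h.smooth_right i j).piecewise_le (h'.smooth_right i j) (b := b)
      (hV.mono fun t ht => by simp only [ht])
    convert this using 2 with t
    simp only [hV₁]
    split_ifs <;> rfl
  · rintro t₀ (⟨h1, h2⟩ | ⟨h1, h2⟩)
    · filter_upwards [hleft t₀ h2, h.eventually t₀ h1] with t ht h3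
      simpa only [ht] using h3
    · filter_upwards [hright t₀ h2, h'.eventually t₀ h1] with t ht h3
      simpa only [ht] using h3

end IsEigenframeOn

end Gluing

/-! ### From local to global eigenframes -/

section Global

variable {ι : Type*} [Fintype ι] [DecidableEq ι] {A : ℝ → Matrix ι ι ℂ}

theorem HasLocalEigenframes.exists_isEigenframeOn_Icc_trans (hA : HasLocalEigenframes A)
    {a b c : ℝ} (hab : a ≤ b) (hbc : b ≤ c) (h : ∃ d V, IsEigenframeOn A (Set.Icc a b) d V)
    (h' : ∃ d V, IsEigenframeOn A (Set.Icc b c) d V) :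
    ∃ d V, IsEigenframeOn A (Set.Icc a c) d V := by
  obtain ⟨d, V, h⟩ := h
  obtain ⟨e, W, h'⟩ := h'
  obtain ⟨d', V', hd, -⟩ := h.exists_glue hA isPreconnected_Icc (Set.right_mem_Icc.2 hab)
    (Set.left_mem_Icc.2 hbc) h'
  refine ⟨d', V', hd.mono fun t ht => ?_⟩
  rcases le_total t b with htb | htb
  · exact Or.inl ⟨⟨ht.1, htb⟩, htb⟩
  · exact Or.inr ⟨⟨htb, ht.2⟩, htb⟩

/-- Having a frame along the segment between two points is a symmetric relation, transitive by
gluing or restriction, that holds for nearby points; connectedness of `ℝ` does the rest. -/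
theorem HasLocalEigenframes.exists_isEigenframeOn_uIcc (hA : HasLocalEigenframes A) (a b : ℝ) :
    ∃ d V, IsEigenframeOn A (Set.uIcc a b) d V := by
  refine isPreconnected_univ.induction₂
    (fun x y : ℝ => ∃ d V, IsEigenframeOn A (Set.uIcc x y) d V) (fun x _ => ?_)
    (fun x y z _ _ _ hxy hyz => ?_) (fun x y _ _ h => by rwa [Set.uIcc_comm])
    (Set.mem_univ a) (Set.mem_univ b)
  · obtain ⟨d, V, h⟩ := hA x
    refine nhdsWithin_le_nhds ?_
    obtain ⟨ε, hε, hball⟩ := Metric.mem_nhds_iff.1 h.eventually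
    filter_upwards [Metric.ball_mem_nhds x hε] with y hy
    refine ⟨d, V, h.smooth_left, h.smooth_right, fun t ht => ?_⟩
    have htb : t ∈ Metric.ball x ε :=
      ((convex_ball x ε).ordConnected.uIcc_subset (Metric.mem_ball_self hε) hy) ht
    exact Filter.mem_of_superset (Metric.isOpen_ball.mem_nhds htb) hball
  · have mono : ∀ {S T : Set ℝ}, S ⊆ T → (∃ d V, IsEigenframeOn A T d V) →
        ∃ d V, IsEigenframeOn A S d V := fun hST ⟨d, V, h⟩ => ⟨d, V, h.mono hST⟩
    rcases le_total x y with h1 | h1 <;> rcases le_total y z with h2 | h2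
    · rw [Set.uIcc_of_le h1] at hxy
      rw [Set.uIcc_of_le h2] at hyz
      rw [Set.uIcc_of_le (h1.trans h2)]
      exact hA.exists_isEigenframeOn_Icc_trans h1 h2 hxy hyz
    · rcases le_total x z with h3 | h3
      · exact mono (Set.uIcc_subset_uIcc_left (Set.mem_uIcc_of_le h3 h2)) hxy
      · exact mono (Set.uIcc_subset_uIcc_right (Set.mem_uIcc_of_ge h3 h1)) hyz
    · rcases le_total x z with h3 | h3
      · exact mono (Set.uIcc_subset_uIcc_right (Set.mem_uIcc_of_le h1 h3)) hyz
      · exact mono (Set.uIcc_subset_uIcc_left (Set.mem_uIcc_of_ge h2 h3)) hxy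
    · rw [Set.uIcc_of_ge h1] at hxy
      rw [Set.uIcc_of_ge h2] at hyz
      rw [Set.uIcc_of_ge (h2.trans h1)]
      exact hA.exists_isEigenframeOn_Icc_trans h2 h1 hyz hxy

/-- A frame on `[0, n]` extends to `[0, n + 1]` without any change at points `t ≤ n`, so the
successive frames stabilize. -/
theorem HasLocalEigenframes.exists_isEigenframeOn_Ici (hA : HasLocalEigenframes A) :
    ∃ d V, IsEigenframeOn A (Set.Ici 0) d V := by
  have hstep : ∀ (n : ℕ) (F : {F : (ι → ℝ → ℝ) × (ℝ → Matrix ι ι ℂ) //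
      IsEigenframeOn A (Set.Icc 0 n) F.1 F.2}),
      ∃ G : {F : (ι → ℝ → ℝ) × (ℝ → Matrix ι ι ℂ) //
        IsEigenframeOn A (Set.Icc 0 (n + 1 : ℕ)) F.1 F.2},
        ∀ t ≤ (n : ℝ), (∀ i, G.1.1 i t = F.1.1 i t) ∧ G.1.2 t = F.1.2 t := by
    rintro n ⟨⟨d, V⟩, h⟩
    obtain ⟨e, W, h'⟩ := hA.exists_isEigenframeOn_uIcc n (n + 1 : ℕ)
    have hn : (n : ℝ) ≤ (n + 1 : ℕ) := by exact_mod_cast n.le_succ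
    rw [Set.uIcc_of_le hn] at h'
    obtain ⟨d', V', hd, heq⟩ := h.exists_glue hA isPreconnected_Icc
      (Set.right_mem_Icc.2 n.cast_nonneg) (Set.left_mem_Icc.2 hn) h'
    refine ⟨⟨⟨d', V'⟩, hd.mono fun t ht => ?_⟩, heq⟩
    rcases le_total t n with htb | htb
    · exact Or.inl ⟨⟨ht.1, htb⟩, htb⟩
    · exact Or.inr ⟨⟨htb, ht.2⟩, htb⟩
  choose next hnext using hstep
  obtain ⟨d₀, V₀, h₀⟩ := hA.exists_isEigenframeOn_uIcc 0 0
  rw [Set.uIcc_self, ← Set.Icc_self] at h₀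
  let F : ∀ n : ℕ, {F : (ι → ℝ → ℝ) × (ℝ → Matrix ι ι ℂ) //
      IsEigenframeOn A (Set.Icc 0 n) F.1 F.2} :=
    fun n => Nat.rec ⟨⟨d₀, V₀⟩, by simpa using h₀⟩ next n
  have hF : ∀ n m : ℕ, n ≤ m → ∀ t ≤ (n : ℝ),
      (∀ i, (F m).1.1 i t = (F n).1.1 i t) ∧ (F m).1.2 t = (F n).1.2 t := by
    intro n m hnm
    induction m, hnm using Nat.le_induction with
    | base => exact fun t _ => ⟨fun _ => rfl, rfl⟩
    | succ m hnm ih =>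
      intro t ht
      have h1 := hnext m (F m) t (ht.trans (by exact_mod_cast hnm))
      have h2 := ih t ht
      exact ⟨fun i => (h1.1 i).trans (h2.1 i), h1.2.trans h2.2⟩
  -- The added `1` makes `t < k t` strict, so that near `t₀` the frame of index `k t₀` is already
  -- final.
  set k : ℝ → ℕ := fun t => ⌊t⌋₊ + 1 with hk
  have hkt : ∀ t : ℝ, t < k t := fun t => by
    simpa [hk] using Nat.lt_floor_add_one t
  have hnear : ∀ t₀ : ℝ, ∀ᶠ t in 𝓝 t₀, (∀ i, (F (k t)).1.1 i t = (F (k t₀)).1.1 i t) ∧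
      (F (k t)).1.2 t = (F (k t₀)).1.2 t := by
    intro t₀
    filter_upwards [gt_mem_nhds (hkt t₀)] with t ht
    rcases le_total (k t) (k t₀) with h | h
    · have := hF _ _ h t (hkt t).le
      exact ⟨fun i => (this.1 i).symm, this.2.symm⟩
    · exact hF _ _ h t (le_of_lt ht)
  refine ⟨fun i t => (F (k t)).1.1 i t, fun t => (F (k t)).1.2 t, fun i => ?_, fun i j => ?_, ?_⟩
  · refine contDiff_iff_contDiffAt.2 fun t₀ => ?_
    exact ((F (k t₀)).2.smooth_left i).contDiffAt.congr_of_eventuallyEq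
      ((hnear t₀).mono fun t ht => ht.1 i)
  · refine contDiff_iff_contDiffAt.2 fun t₀ => ?_
    exact ((F (k t₀)).2.smooth_right i j).contDiffAt.congr_of_eventuallyEq
      ((hnear t₀).mono fun t ht => congrFun (congrFun ht.2 i) j)
  · intro t₀ ht₀
    filter_upwards [hnear t₀, (F (k t₀)).2.eventually t₀ ⟨ht₀, (hkt t₀).le⟩] with t ht h
    simpa only [ht] using h

theorem HasLocalEigenframes.comp_neg (hA : HasLocalEigenframes A) :
    HasLocalEigenframes fun t => A (-t) := by
  intro t₀
  obtain ⟨d, V, h⟩ := hA (-t₀)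
  have ht : Filter.Tendsto (fun t : ℝ => -t) (𝓝 t₀) (𝓝 (-t₀)) := continuous_neg.tendsto t₀
  refine ⟨fun i t => d i (-t), fun t => V (-t), fun i => (h.smooth_left i).comp contDiff_neg,
    h.smooth_right.comp contDiff_neg, ht.eventually h.eventually, fun i j => ?_⟩
  rcases h.separated i j with h1 | ⟨N, hN⟩
  · exact Or.inl (ht.eventually h1)
  · refine Or.inr ⟨N, ?_⟩
    have h2 := (hN.comp_tendsto ht).norm_left
    refine Asymptotics.IsBigO.of_norm_left (h2.congr_left fun t => ?_)
    simp only [Function.comp_apply, norm_pow]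
    rw [← norm_neg]
    congr 2
    ring

theorem IsEigenframeOn.comp_neg {S : Set ℝ} {d : ι → ℝ → ℝ} {V : ℝ → Matrix ι ι ℂ}
    (h : IsEigenframeOn (fun t => A (-t)) S d V) :
    IsEigenframeOn A (-S) (fun i t => d i (-t)) fun t => V (-t) where
  smooth_left i := (h.smooth_left i).comp contDiff_neg
  smooth_right := h.smooth_right.comp contDiff_neg
  eventually t₀ ht₀ := by
    have ht : Filter.Tendsto (fun t : ℝ => -t) (𝓝 t₀) (𝓝 (-t₀)) := continuous_neg.tendsto t₀
    filter_upwards [ht.eventually (h.eventually (-t₀) ht₀)] with t ht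
    simpa only [neg_neg] using ht

/-- Local eigenframes can be glued to a global one. -/
theorem HasLocalEigenframes.exists_isEigenframeOn_univ (hA : HasLocalEigenframes A) :
    ∃ d V, IsEigenframeOn A Set.univ d V := by
  obtain ⟨d, V, h⟩ := hA.exists_isEigenframeOn_Ici
  obtain ⟨e, W, h'⟩ := hA.comp_neg.exists_isEigenframeOn_Ici
  obtain ⟨d', V', hd, -⟩ := h'.comp_neg.exists_glue hA isPreconnected_Ici (b := 0) (by simp)
    (by simp) h
  refine ⟨d', V', hd.mono fun t _ => ?_⟩
  rcases le_total t 0 with ht | ht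
  · exact Or.inl ⟨by simpa using ht, ht⟩
  · exact Or.inr ⟨ht, ht⟩

end Global

/-! ### The main theorem -/

theorem IsContinuousEigenvalues.hasTameSpectrum {n : ℕ} {A : ℝ → Matrix (Fin n) (Fin n) ℂ}
    {μ : Fin n → ℝ → ℝ} (hμ : IsContinuousEigenvalues A μ) {t₀ : ℝ} {l : Filter ℝ}
    (h : ∀ i j, μ i ≠ μ j →
      ¬ ∀ N : ℕ, (fun t => μ i t - μ j t) =O[l] fun t => (t - t₀) ^ N) :
    HasTameSpectrum A t₀ l := by
  refine ⟨Fin n, inferInstance, μ, fun k => Filter.Eventually.of_forall fun t =>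
    (hμ.continuous k).continuousAt, Filter.Eventually.of_forall fun t x => ?_, fun j k hjk => ?_⟩
  · rw [hμ.charpoly_eq, isRoot_prod_X_sub_C]
  · by_cases hne : μ j = μ k
    · rw [hne]
    · exact absurd hjk (h j k hne)

theorem mainTheorem4 (n : ℕ) (A : ℝ → Matrix (Fin n) (Fin n) ℂ)
    (hA_smooth : ∀ i j, ContDiff ℝ ∞ (fun t => A t i j))
    (hA_herm : ∀ t, (A t).IsHermitian)
    (μ : Fin n → ℝ → ℝ) (hμ : IsContinuousEigenvalues A μ)
    (hmeet : ∀ i j, μ i ≠ μ j → ∀ t₀, ¬ MeetOfInfiniteOrderAt (μ i) (μ j) t₀) :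
    ∃ (eval : Fin n → ℝ → ℝ) (evec : Fin n → ℝ → EuclideanSpace ℂ (Fin n)),
      (∀ i, ContDiff ℝ ∞ (eval i)) ∧
      (∀ i, ContDiff ℝ ∞ (evec i)) ∧
      (∀ t, (A t).charpoly = ∏ i, (Polynomial.X - Polynomial.C (eval i t : ℂ))) ∧
      (∀ t, Orthonormal ℂ (fun i => evec i t)) ∧
      (∀ t i, Matrix.toEuclideanLin (A t) (evec i t) = (eval i t : ℂ) • evec i t) := by
  have hloc : HasLocalEigenframes A := fun t₀ =>
    exists_isLocalEigenframe t₀ n (Fin n) (Fintype.card_fin n) A hA_smooth hA_herm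
      (hμ.hasTameSpectrum fun i j hij h => hmeet i j hij t₀ (Or.inl h))
      (hμ.hasTameSpectrum fun i j hij h => hmeet i j hij t₀ (Or.inr h))
  obtain ⟨d, V, h⟩ := hloc.exists_isEigenframeOn_univ
  have hframe : ∀ t, IsEigenframe (A t) (fun i => d i t) (V t) := fun t =>
    (h.eventually t (Set.mem_univ t)).self_of_nhds
  refine ⟨d, fun i t => WithLp.toLp 2 fun j => V t j i, h.smooth_left, fun i => ?_,
    fun t => (hframe t).charpoly_eq, fun t => ?_, fun t i => ?_⟩
  · exact (contDiff_piLp 2).2 fun j => h.smooth_right j i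
  · rw [orthonormal_iff_ite]
    intro i j
    have := congrFun (congrFun (hframe t).1 i) j
    simp only [Matrix.mul_apply, Matrix.conjTranspose_apply, Matrix.one_apply] at this
    rw [← this]
    simp [PiLp.inner_apply, mul_comm]
  · ext j
    have := congrFun (congrFun (hframe t).2 j) i
    rw [Matrix.mul_diagonal, Matrix.mul_apply] at this
    simp [Matrix.toLpLin_apply, Matrix.mulVec, dotProduct, this, mul_comm]
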